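/- \textbf{Online sorting.} A sequence $X=(x_1,\dots,x_n)$ of reals is revealed one item at a time, and each item must immediately and irrevocably be placed into an empty cell of an array $A[1],\dots,A[n]$. The cost of the resulting arrangement is $\sum_{i=1}^{n-1}|A[i+1]-A[i]|$, and $\mathrm{OPT}(X)$ is the minimum cost over all arrangements of $x_1,\dots,x_n$ in the array. A deterministic online algorithm $\mathcal A$ (for given $n$) chooses the cell of $x_j$ depending only on $x_1,\dots,x_j$; write $\mathcal A(X)$ for its cost on $X$. A randomized online algorithm is a probability distribution over deterministic ones. The competitive ratio $C_{\mathcal A}(n)$ is the supremum over inputs $X$ of length $n$, fixed independently of the random choices of $\mathcal A$ (oblivious adversary), of $\mathcal A(X)/\mathrm{OPT}(X)$ for deterministic, and of $\mathbb E[\mathcal A(X)]/\mathrm{OPT}(X)$ for randomized $\mathcal A$ (inputs with all items equal, for which every cost is $0$, are disregarded). The deterministic (randomized) competitive ratio of online sorting of $n$ items is the infimum of $C_{\mathcal A}(n)$ over all deterministic (randomized) online algorithms $\mathcal A$. \textbf{Theorem.} The deterministic and the randomized competitive ratio of online sorting of $n$ reals are both $\Theta(\sqrt n)$: there are absolute constants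 $c,C>0$ such that for every $n\ge 2$ both lie between $c\sqrt n$ and $C\sqrt n$. Moreover, for every $n\ge 2$ some deterministic online algorithm has competitive ratio at most $C\sqrt n$ on arbitrary real inputs, and both lower bounds $c\sqrt n$ hold even if the supremum in $C_{\mathcal A}(n)$ is restricted to inputs with all items in $[0,1]$. -/

import Mathlib

open MeasureTheory
open scoped ENNReal

namespace OnlineSorting

/-- The cost `D_f(X)`: array cell `i` holds `A[i] = X (f i)`, and the cost is the sum of
`|A[i+1] - A[i]|` over the `n - 1` pairs of consecutive cells. -/
noncomputable def cost {n : ℕ} (X : Fin n → ℝ) (f : Equiv.Perm (Fin n)) : ℝ :=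
  ∑ i : Fin (n - 1), |X (f ⟨i.val + 1, by omega⟩) - X (f ⟨i.val, by omega⟩)|

/-- The offline optimum: the minimum cost over all arrangements of the items. -/
noncomputable def opt {n : ℕ} (X : Fin n → ℝ) : ℝ :=
  Finset.univ.inf' ⟨1, Finset.mem_univ 1⟩ (fun f : Equiv.Perm (Fin n) => cost X f)

/-- A deterministic online algorithm for `n` items and an array with `n` cells.
On input `X` it produces an arrangement (`arrange X i` is the index of the item in cell `i`),
and the cell `(arrange X).symm j` that receives item `j` depends only on the items `0, …, j`. -/
structure Algorithm (n : ℕ) where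
  arrange : (Fin n → ℝ) → Equiv.Perm (Fin n)
  online : ∀ (X Y : Fin n → ℝ) (j : Fin n), (∀ i, i ≤ j → X i = Y i) →
    (arrange X).symm j = (arrange Y).symm j

/-- A randomized online algorithm: a random deterministic online algorithm, driven by a
probability space of random choices. On each fixed input, every arrangement is produced
with a well-defined probability. -/
structure RandomizedAlgorithm (n : ℕ) where
  Ω : Type
  [mΩ : MeasurableSpace Ω]
  μ : Measure Ω
  [isProb : IsProbabilityMeasure μ]
  alg : Ω → Algorithm n
  measurableSet_arrange : ∀ (X : Fin n → ℝ) (f : Equiv.Perm (Fin n)),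
    MeasurableSet {ω | (alg ω).arrange X = f}

/-- The expected cost of a randomized algorithm on a fixed input (oblivious adversary). -/
noncomputable def RandomizedAlgorithm.expectedCost {n : ℕ} (A : RandomizedAlgorithm n)
    (X : Fin n → ℝ) : ℝ≥0∞ :=
  letI := A.mΩ
  ∫⁻ ω, ENNReal.ofReal (cost X ((A.alg ω).arrange X)) ∂A.μ

/-- The competitive ratio of a deterministic algorithm on inputs with all items in `S`: the
supremum of cost divided by optimum. In `ℝ≥0∞` we have `0 / 0 = 0`, so inputs whose items are
all equal (where every arrangement costs `0`) do not contribute. -/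
noncomputable def Algorithm.ratio {n : ℕ} (S : Set ℝ) (A : Algorithm n) : ℝ≥0∞ :=
  ⨆ (X : Fin n → ℝ) (_ : ∀ i, X i ∈ S),
    ENNReal.ofReal (cost X (A.arrange X)) / ENNReal.ofReal (opt X)

/-- The competitive ratio of a randomized algorithm on inputs with all items in `S`: the
supremum of expected cost divided by optimum. -/
noncomputable def RandomizedAlgorithm.ratio {n : ℕ} (S : Set ℝ) (A : RandomizedAlgorithm n) :
    ℝ≥0∞ :=
  ⨆ (X : Fin n → ℝ) (_ : ∀ i, X i ∈ S), A.expectedCost X / ENNReal.ofReal (opt X)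

/-- The deterministic competitive ratio of online sorting of `n` items from `S`. -/
noncomputable def detRatio (S : Set ℝ) (n : ℕ) : ℝ≥0∞ :=
  ⨅ A : Algorithm n, A.ratio S

/-- The randomized competitive ratio of online sorting of `n` items from `S`. -/
noncomputable def randRatio (S : Set ℝ) (n : ℕ) : ℝ≥0∞ :=
  ⨅ A : RandomizedAlgorithm n, A.ratio S

end OnlineSorting

/-!
Both bounds rest on potential functions.

**Lower bound.** Fix `k` of order `√n`. The input consists of a uniformly random sequence of
multiples of `1 / k` up to a random time `T`, and then of a constant `v ∈ {0, 1}`. For a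
deterministic algorithm let `c` be the cost of the pairs of adjacent cells which are filled at time
`T`, and let `b` be the number of pairs with exactly one filled cell. Completing the input with
zeros and completing it with ones together cost exactly `2 c + b` (`cost_stopped_add`). A new item
can avoid both a new cost of `1 / k` and an increase of `b` only if it equals one of the at most `b`
values at the boundary of the filled region, which has probability at most `b / k`; hence
`2 k c + b` grows in expectation by at least `1 - (2 / k) b` per item (`sum_gain`). So either `b` is
of order `k` for a typical `T`, or `c` is of order `n / k` (`sum_ge_of_gain`). Averaging over these
finitely many inputs, all with optimum at most `1`, gives the bound for randomized algorithms
(`randRatio_ge`), and a deterministic algorithm is a special case.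

**Upper bound.** The optimum is the range of the input. The algorithm keeps a scale `L`, which at
least doubles whenever an item is farther than `L` from the first item `x₀`, and it divides
`[x₀ - L, x₀ + L]` into about `2 q` buckets of length `L / q`, where `q` is of order `√m` for the
current number `m` of empty cells. An item goes to the right of a filled cell of its own bucket, if
such a cell has an empty right neighbour; otherwise next to a filled cell whose bucket is available
at another such place; otherwise there are at most `2 q` stretches of empty cells, so one of them
has length at least `q / 2`, and the item goes into its middle (or to its left end if it has at most
two cells, which happens only for `q ≤ 4`). The cost is controlled by
`potential`: no placement increases it (`exists_placement`), neither does halving `q`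
(`potential_coarsen`), and its bound of order `L √n` absorbs the effect of a new scale
(`Good.rescale`), because the scales grow geometrically.
-/

namespace OnlineSorting

/-! ### The optimum is the range of the input -/

/-- The content of cell `i` of the array, extended by `0` to all natural numbers. -/
noncomputable def content {n : ℕ} (X : Fin n → ℝ) (f : Equiv.Perm (Fin n)) (i : ℕ) : ℝ :=
  if h : i < n then X (f ⟨i, h⟩) else 0

lemma content_of_lt {n : ℕ} (X : Fin n → ℝ) (f : Equiv.Perm (Fin n)) {i : ℕ} (h : i < n) :
    content X f i = X (f ⟨i, h⟩) := dif_pos h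

lemma cost_eq_sum_range {n : ℕ} (X : Fin n → ℝ) (f : Equiv.Perm (Fin n)) :
    cost X f = ∑ i ∈ Finset.range (n - 1), |content X f (i + 1) - content X f i| := by
  rw [Finset.sum_range, cost]
  refine Finset.sum_congr rfl fun i _ => ?_
  rw [content_of_lt, content_of_lt]

lemma cost_nonneg {n : ℕ} (X : Fin n → ℝ) (f : Equiv.Perm (Fin n)) : 0 ≤ cost X f :=
  Finset.sum_nonneg fun _ _ => abs_nonneg _

lemma abs_sub_le_cost {n : ℕ} (X : Fin n → ℝ) (f : Equiv.Perm (Fin n)) (i j : Fin n) :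
    |X i - X j| ≤ cost X f := by
  have key : ∀ p q : Fin n, p ≤ q → |X (f p) - X (f q)| ≤ cost X f := by
    intro p q hpq
    rw [← content_of_lt X f p.2, ← content_of_lt X f q.2, ← Real.dist_eq, cost_eq_sum_range]
    refine (dist_le_Ico_sum_dist (content X f) (Fin.le_def.1 hpq)).trans ?_
    simp_rw [Real.dist_eq, abs_sub_comm (content X f _) (content X f (_ + 1))]
    refine Finset.sum_le_sum_of_subset_of_nonneg ?_ fun _ _ _ => abs_nonneg _
    intro k hk
    have := q.2
    simp only [Finset.mem_Ico, Finset.mem_range] at hk ⊢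
    omega
  rcases le_total (f.symm i) (f.symm j) with h | h
  · simpa using key _ _ h
  · rw [abs_sub_comm]; simpa using key _ _ h

lemma abs_sub_le_opt {n : ℕ} (X : Fin n → ℝ) (i j : Fin n) : |X i - X j| ≤ opt X :=
  Finset.le_inf' _ _ fun f _ => abs_sub_le_cost X f i j

lemma opt_nonneg {n : ℕ} (X : Fin n → ℝ) : 0 ≤ opt X :=
  Finset.le_inf' _ _ fun f _ => cost_nonneg X f

lemma opt_le_one {n : ℕ} {X : Fin n → ℝ} (hX : ∀ i, X i ∈ Set.Icc (0 : ℝ) 1) : opt X ≤ 1 := by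
  refine (Finset.inf'_le _ (Finset.mem_univ (Tuple.sort X))).trans ?_
  rw [cost_eq_sum_range]
  have hmono := Tuple.monotone_sort X
  have hbd : ∀ i, content X (Tuple.sort X) i ∈ Set.Icc (0 : ℝ) 1 := by
    intro i
    unfold content
    split_ifs
    · exact hX _
    · simp
  have : ∀ i ∈ Finset.range (n - 1),
      |content X (Tuple.sort X) (i + 1) - content X (Tuple.sort X) i| =
        content X (Tuple.sort X) (i + 1) - content X (Tuple.sort X) i := by
    intro i hi
    rw [Finset.mem_range] at hi
    rw [content_of_lt X _ (show i < n by omega), content_of_lt X _ (show i + 1 < n by omega)]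
    exact abs_of_nonneg (sub_nonneg.2 (hmono (Fin.le_def.2 (Nat.le_succ i))))
  rw [Finset.sum_congr rfl this, Finset.sum_range_sub]
  linarith [(hbd (n - 1)).2, (hbd 0).1]

/-! ### Pairs of adjacent cells after `T` items -/

/-- The left cell of the `i`-th pair of adjacent cells. -/
def leftCell {n : ℕ} (i : Fin (n - 1)) : Fin n := ⟨i.val, by omega⟩

/-- The right cell of the `i`-th pair of adjacent cells. -/
def rightCell {n : ℕ} (i : Fin (n - 1)) : Fin n := ⟨i.val + 1, by omega⟩

/-- Contribution of the `i`-th pair of adjacent cells to the cost when only the items before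
time `T` are present. -/
noncomputable def filledTerm {n : ℕ} (T : ℕ) (X : Fin n → ℝ) (f : Equiv.Perm (Fin n))
    (i : Fin (n - 1)) : ℝ :=
  if (f (leftCell i)).val < T ∧ (f (rightCell i)).val < T then
    |X (f (rightCell i)) - X (f (leftCell i))| else 0

/-- Indicator that exactly one cell of the `i`-th pair of adjacent cells is filled by the items
before time `T`. -/
noncomputable def mixedTerm {n : ℕ} (T : ℕ) (f : Equiv.Perm (Fin n)) (i : Fin (n - 1)) : ℝ :=
  if ((f (leftCell i)).val < T ∧ ¬ (f (rightCell i)).val < T) ∨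
    (¬ (f (leftCell i)).val < T ∧ (f (rightCell i)).val < T) then 1 else 0

/-- Indicator that item `T` goes into the `i`-th pair of adjacent cells, next to an earlier item
of the same value. -/
noncomputable def collisionTerm {n : ℕ} (T : ℕ) (X : Fin n → ℝ) (f : Equiv.Perm (Fin n))
    (i : Fin (n - 1)) : ℝ :=
  if (((f (leftCell i)).val = T ∧ (f (rightCell i)).val < T) ∨
    ((f (rightCell i)).val = T ∧ (f (leftCell i)).val < T)) ∧
      X (f (leftCell i)) = X (f (rightCell i)) then 1 else 0

/-- Indicator that item `T` goes into the `i`-th pair of adjacent cells. -/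
noncomputable def incidentTerm {n : ℕ} (T : ℕ) (f : Equiv.Perm (Fin n)) (i : Fin (n - 1)) : ℝ :=
  if (f (leftCell i)).val = T ∨ (f (rightCell i)).val = T then 1 else 0

lemma filledTerm_nonneg {n : ℕ} (T : ℕ) (X : Fin n → ℝ) (f : Equiv.Perm (Fin n))
    (i : Fin (n - 1)) : 0 ≤ filledTerm T X f i := by
  unfold filledTerm; split_ifs <;> positivity

lemma mixedTerm_nonneg {n : ℕ} (T : ℕ) (f : Equiv.Perm (Fin n)) (i : Fin (n - 1)) :
    0 ≤ mixedTerm T f i := by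
  unfold mixedTerm; split_ifs <;> positivity

/-- A new item turns each incident pair from empty to mixed, or from mixed to filled; in the
second case the loss of a mixed pair is made up for by the cost `1 / k` of two different values,
unless the values collide. -/
lemma pair_gain {n : ℕ} {k : ℝ} {X : Fin n → ℝ}
    (hX : ∀ a b, X a ≠ X b → 1 ≤ k * |X a - X b|) (hk : 0 ≤ k) (T : ℕ)
    (f : Equiv.Perm (Fin n)) (i : Fin (n - 1)) :
    2 * k * filledTerm T X f i + mixedTerm T f i + incidentTerm T f i
        - 2 * collisionTerm T X f i ≤
      2 * k * filledTerm (T + 1) X f i + mixedTerm (T + 1) f i := by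
  have hne : (f (leftCell i)).val ≠ (f (rightCell i)).val := by
    intro h
    have := f.injective (Fin.ext h)
    simp [leftCell, rightCell] at this
  have hX' := hX (f (rightCell i)) (f (leftCell i))
  have hpos : 0 ≤ k * |X (f (rightCell i)) - X (f (leftCell i))| := by positivity
  unfold filledTerm mixedTerm incidentTerm collisionTerm
  generalize X (f (rightCell i)) = u at *
  generalize X (f (leftCell i)) = v at *
  generalize (f (leftCell i)).val = a at *
  generalize (f (rightCell i)).val = b at *
  by_cases huv : v = u
  · simp only [huv, and_true, sub_self, abs_zero]
    split_ifs <;> first | linarith | (exfalso; omega)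
  · have := hX' (Ne.symm huv)
    simp only [huv, and_false, if_false]
    split_ifs <;> first | linarith | (exfalso; omega)

lemma one_le_sum_incidentTerm {n : ℕ} (hn : 2 ≤ n) {T : ℕ} (hT : T < n)
    (f : Equiv.Perm (Fin n)) : 1 ≤ ∑ i, incidentTerm T f i := by
  have hnn : ∀ i ∈ (Finset.univ : Finset (Fin (n - 1))), 0 ≤ incidentTerm T f i := by
    intro i _
    unfold incidentTerm; split_ifs <;> positivity
  obtain ⟨p, hp⟩ : ∃ p : Fin n, (f p).val = T := ⟨f.symm ⟨T, hT⟩, by simp⟩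
  obtain ⟨i, hi⟩ : ∃ i : Fin (n - 1), leftCell i = p ∨ rightCell i = p := by
    have := p.2
    by_cases h : p.val < n - 1
    · exact ⟨⟨p.val, h⟩, Or.inl rfl⟩
    · exact ⟨⟨p.val - 1, by omega⟩, Or.inr (Fin.ext (by simp only [rightCell]; omega))⟩
  refine le_trans (le_of_eq ?_) (Finset.single_le_sum hnn (Finset.mem_univ i))
  unfold incidentTerm
  rcases hi with hi | hi <;> simp [hi, hp]

/-! ### Inputs stopped at time `T` -/

/-- The cells of the items before time `T` depend on these items only. -/
lemma Algorithm.arrange_congr {n : ℕ} (A : Algorithm n) {X Y : Fin n → ℝ} {T : ℕ}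
    (h : ∀ i : Fin n, i.val < T → X i = Y i) {p : Fin n} (hp : (A.arrange X p).val < T) :
    A.arrange Y p = A.arrange X p := by
  have := A.online X Y (A.arrange X p) fun i hi => h i (lt_of_le_of_lt (Fin.le_def.1 hi) hp)
  rw [Equiv.symm_apply_apply, Equiv.eq_symm_apply] at this
  exact this

lemma Algorithm.arrange_lt_iff {n : ℕ} (A : Algorithm n) {X Y : Fin n → ℝ} {T : ℕ}
    (h : ∀ i : Fin n, i.val < T → X i = Y i) (p : Fin n) :
    (A.arrange Y p).val < T ↔ (A.arrange X p).val < T := by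
  constructor
  · intro hp
    rwa [← A.arrange_congr (fun i hi => (h i hi).symm) hp] at hp
  · intro hp
    rwa [A.arrange_congr h hp]

/-- The input that agrees with `X` before time `T` and is constantly `v` from then on. -/
noncomputable def stopped {n : ℕ} (X : Fin n → ℝ) (T : ℕ) (v : ℝ) : Fin n → ℝ :=
  fun j => if j.val < T then X j else v

lemma stopped_mem_Icc {n : ℕ} {X : Fin n → ℝ} (hX : ∀ j, X j ∈ Set.Icc (0 : ℝ) 1) (T : ℕ) {v : ℝ}
    (hv : v ∈ Set.Icc (0 : ℝ) 1) (j : Fin n) : stopped X T v j ∈ Set.Icc (0 : ℝ) 1 := by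
  unfold stopped
  split_ifs
  exacts [hX j, hv]

lemma stopped_arrange {n : ℕ} (A : Algorithm n) (X : Fin n → ℝ) (T : ℕ) (v : ℝ) (p : Fin n) :
    stopped X T v (A.arrange (stopped X T v) p) =
      if (A.arrange X p).val < T then X (A.arrange X p) else v := by
  have h : ∀ i : Fin n, i.val < T → X i = stopped X T v i := fun i hi => by simp [stopped, hi]
  by_cases hp : (A.arrange X p).val < T
  · rw [A.arrange_congr h hp, if_pos hp, ← h _ hp]
  · have := mt (A.arrange_lt_iff h p).1 hp
    rw [if_neg hp, stopped, if_neg this]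

/-- Continuing with all zeros or with all ones makes each mixed pair cost `1` in total, since
`|a - 0| + |a - 1| = 1` for `a ∈ [0, 1]`. -/
lemma cost_stopped_add {n : ℕ} (A : Algorithm n) {X : Fin n → ℝ}
    (hX : ∀ j, X j ∈ Set.Icc (0 : ℝ) 1) (T : ℕ) :
    cost (stopped X T 0) (A.arrange (stopped X T 0)) +
        cost (stopped X T 1) (A.arrange (stopped X T 1)) =
      ∑ i, (2 * filledTerm T X (A.arrange X) i + mixedTerm T (A.arrange X) i) := by
  have hc : ∀ v : ℝ, cost (stopped X T v) (A.arrange (stopped X T v)) =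
      ∑ i : Fin (n - 1), |(if (A.arrange X (rightCell i)).val < T then X (A.arrange X (rightCell i))
        else v) - (if (A.arrange X (leftCell i)).val < T then X (A.arrange X (leftCell i))
        else v)| := by
    intro v
    unfold cost
    refine Finset.sum_congr rfl fun i _ => ?_
    rw [← stopped_arrange, ← stopped_arrange]
    rfl
  rw [hc, hc, ← Finset.sum_add_distrib]
  refine Finset.sum_congr rfl fun i _ => ?_
  unfold filledTerm mixedTerm
  have hr := hX (A.arrange X (rightCell i))
  have hl := hX (A.arrange X (leftCell i))
  have key : ∀ a : ℝ, a ∈ Set.Icc (0 : ℝ) 1 → |a - 0| + |a - 1| = 1 := by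
    intro a ha
    rw [abs_of_nonneg (by linarith [ha.1]), abs_of_nonpos (by linarith [ha.2])]
    ring
  have key' : ∀ a : ℝ, a ∈ Set.Icc (0 : ℝ) 1 → |0 - a| + |1 - a| = 1 := by
    intro a ha
    rw [abs_sub_comm, abs_sub_comm 1, key a ha]
  by_cases h1 : (A.arrange X (rightCell i)).val < T <;>
    by_cases h2 : (A.arrange X (leftCell i)).val < T
  · simp only [h1, h2]; simp; ring
  · simp only [h1, h2, if_true, if_false]
    rw [key _ hr]; simp
  · simp only [h1, h2, if_true, if_false]
    rw [key' _ hl]; simp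
  · simp [h1, h2]

/-! ### Averaging over grid inputs -/

/-- The input with items `x j / k`. -/
noncomputable def gridInput {n k : ℕ} (x : Fin n → Fin k) : Fin n → ℝ :=
  fun j => ((x j).val : ℝ) / k

lemma gridInput_mem_Icc {n k : ℕ} (x : Fin n → Fin k) (j : Fin n) :
    gridInput x j ∈ Set.Icc (0 : ℝ) 1 := by
  have hk : (0 : ℝ) < k := by exact_mod_cast (Nat.zero_le _).trans_lt (x j).2
  have : ((x j).val : ℝ) ≤ k := by exact_mod_cast (x j).2.le
  exact ⟨by unfold gridInput; positivity, (div_le_one hk).2 this⟩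

lemma gridInput_separated {n k : ℕ} (x : Fin n → Fin k) (a b : Fin n)
    (h : gridInput x a ≠ gridInput x b) : 1 ≤ (k : ℝ) * |gridInput x a - gridInput x b| := by
  have hk : (0 : ℝ) < k := by exact_mod_cast (Nat.zero_le _).trans_lt (x a).2
  have hne : ((x a).val : ℤ) ≠ (x b).val := by
    intro h'
    apply h
    unfold gridInput
    rw [show (x a).val = (x b).val by exact_mod_cast h']
  have h1 : (1 : ℤ) ≤ |((x a).val : ℤ) - (x b).val| := Int.one_le_abs (sub_ne_zero.2 hne)
  have h2 : (1 : ℝ) ≤ |((x a).val : ℝ) - (x b).val| := by exact_mod_cast h1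
  have h3 : (k : ℝ) * |gridInput x a - gridInput x b| = |((x a).val : ℝ) - (x b).val| := by
    unfold gridInput
    rw [← sub_div, abs_div, abs_of_pos hk]
    field_simp
  rwa [h3]

lemma sum_sum_update {n k : ℕ} (T : Fin n) (h : (Fin n → Fin k) → ℝ) :
    ∑ x, ∑ v, h (Function.update x T v) = k * ∑ x, h x := by
  rw [← Fintype.sum_prod_type']
  have e : ∑ y : (Fin n → Fin k) × Fin k, h (Function.update y.1 T y.2) =
      ∑ y : (Fin n → Fin k) × Fin k, h y.1 := by
    refine Fintype.sum_bijective (fun y => (Function.update y.1 T y.2, y.1 T)) ?_ _ _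
      fun _ => rfl
    refine Function.Involutive.bijective fun y => ?_
    simp
  rw [e, Fintype.sum_prod_type]
  simp [Finset.mul_sum]

/-- For given earlier items, at most one value of item `T` collides at a given pair of cells, and
only at a mixed pair. -/
lemma sum_collisionTerm_update_le {n k : ℕ} (A : Algorithm n) (x : Fin n → Fin k) (T : Fin n)
    (i : Fin (n - 1)) :
    ∑ v, collisionTerm T (gridInput (Function.update x T v))
        (A.arrange (gridInput (Function.update x T v))) i ≤
      mixedTerm T (A.arrange (gridInput x)) i := by
  set f := A.arrange (gridInput x) with hf
  set w : Fin k := if (f (rightCell i)).val < T.val then x (f (rightCell i)) else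
    x (f (leftCell i)) with hw
  have hle : ∀ v, collisionTerm T (gridInput (Function.update x T v))
        (A.arrange (gridInput (Function.update x T v))) i ≤
      if v = w then mixedTerm T f i else 0 := by
    intro v
    set y := Function.update x T v with hy
    have hag : ∀ j : Fin n, j.val < T.val → gridInput x j = gridInput y j := by
      intro j hj
      have : j ≠ T := fun h => by simp [h] at hj
      simp [gridInput, hy, this]
    have hxy : ∀ j : Fin n, j.val < T.val → y j = x j := by
      intro j hj
      have : j ≠ T := fun h => by simp [h] at hj
      simp [hy, this]
    have hinj : ∀ a b : Fin n, gridInput y a = gridInput y b → y a = y b := by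
      intro a b h
      have hk : (k : ℝ) ≠ 0 := by
        exact_mod_cast ((Nat.zero_le _).trans_lt (y a).2).ne'
      unfold gridInput at h
      rw [div_left_inj' hk] at h
      exact Fin.ext (by exact_mod_cast h)
    have hiff := A.arrange_lt_iff hag
    have hcg := fun p => A.arrange_congr (p := p) fun j hj => (hag j hj).symm
    rw [← hf] at hiff hcg
    unfold collisionTerm
    split_ifs with h1 h2 h2
    · rcases h1 with ⟨⟨h, h'⟩ | ⟨h, h'⟩, -⟩
      · have a1 := (hiff _).1 h'
        have a2 := mt (hiff (leftCell i)).2 (by omega)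
        simp [mixedTerm, a1, a2]
      · have a1 := (hiff _).1 h'
        have a2 := mt (hiff (rightCell i)).2 (by omega)
        simp [mixedTerm, a1, a2]
    · exfalso
      apply h2
      obtain ⟨h1, h3⟩ := h1
      have h3 := hinj _ _ h3
      have hyT : y T = v := by simp [hy]
      rcases h1 with ⟨h, h'⟩ | ⟨h, h'⟩
      · have a1 := (hiff _).1 h'
        rw [Fin.ext h, hyT, ← hcg _ h', hxy _ a1] at h3
        rw [hw, if_pos a1, h3]
      · have a1 := (hiff _).1 h'
        have a2 := mt (hiff (rightCell i)).2 (by omega)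
        rw [Fin.ext h, hyT, ← hcg _ h', hxy _ a1] at h3
        rw [hw, if_neg a2, h3]
    · exact mixedTerm_nonneg _ _ _
    · exact le_rfl
  refine (Finset.sum_le_sum fun v _ => hle v).trans ?_
  simp

/-- Expected growth, for a uniformly random grid input, of `2k` times the cost of the filled
pairs plus the number of mixed pairs. -/
lemma sum_gain {n k : ℕ} (hn : 2 ≤ n) (hk : 0 < k) (A : Algorithm n) {T : ℕ} (hT : T < n) :
    (∑ x : Fin n → Fin k, ∑ i, (2 * k * filledTerm T (gridInput x) (A.arrange (gridInput x)) i +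
        mixedTerm T (A.arrange (gridInput x)) i)) + (k : ℝ) ^ n
        - 2 / k * ∑ x : Fin n → Fin k, ∑ i, mixedTerm T (A.arrange (gridInput x)) i ≤
      ∑ x : Fin n → Fin k, ∑ i,
        (2 * k * filledTerm (T + 1) (gridInput x) (A.arrange (gridInput x)) i +
          mixedTerm (T + 1) (A.arrange (gridInput x)) i) := by
  have hk' : (0 : ℝ) < k := by exact_mod_cast hk
  have h1 : ∑ x : Fin n → Fin k, ∑ i,
      (2 * k * filledTerm T (gridInput x) (A.arrange (gridInput x)) i +
        mixedTerm T (A.arrange (gridInput x)) i + incidentTerm T (A.arrange (gridInput x)) i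
        - 2 * collisionTerm T (gridInput x) (A.arrange (gridInput x)) i) ≤
      ∑ x : Fin n → Fin k, ∑ i,
        (2 * k * filledTerm (T + 1) (gridInput x) (A.arrange (gridInput x)) i +
          mixedTerm (T + 1) (A.arrange (gridInput x)) i) :=
    Finset.sum_le_sum fun x _ => Finset.sum_le_sum fun i _ =>
      pair_gain (gridInput_separated x) hk'.le T _ i
  have h2 : (k : ℝ) ^ n ≤ ∑ x : Fin n → Fin k, ∑ i, incidentTerm T (A.arrange (gridInput x)) i := by
    refine le_trans ?_ (Finset.sum_le_sum fun x _ => one_le_sum_incidentTerm hn hT _)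
    simp
  have h3 : (k : ℝ) * ∑ x : Fin n → Fin k, ∑ i,
      collisionTerm T (gridInput x) (A.arrange (gridInput x)) i ≤
      ∑ x : Fin n → Fin k, ∑ i, mixedTerm T (A.arrange (gridInput x)) i := by
    rw [← sum_sum_update ⟨T, hT⟩ fun x : Fin n → Fin k => ∑ i,
      collisionTerm T (gridInput x) (A.arrange (gridInput x)) i]
    refine Finset.sum_le_sum fun x _ => ?_
    rw [Finset.sum_comm]
    exact Finset.sum_le_sum fun i _ => sum_collisionTerm_update_le A x ⟨T, hT⟩ i
  have h4 : ∑ x : Fin n → Fin k, ∑ i,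
      collisionTerm T (gridInput x) (A.arrange (gridInput x)) i ≤
      1 / k * ∑ x : Fin n → Fin k, ∑ i, mixedTerm T (A.arrange (gridInput x)) i := by
    rw [one_div, ← div_eq_inv_mul, le_div_iff₀ hk', mul_comm]
    exact h3
  simp only [Finset.sum_sub_distrib, Finset.sum_add_distrib, ← Finset.mul_sum] at h1 ⊢
  have h5 : (2 : ℝ) / k = 2 * (1 / k) := by ring
  rw [h5, mul_assoc 2 (1 / (k : ℝ))]
  linarith

/-- If `2k c + b` grows by at least `Q - (2/k) b` in each step, then `2c + b` is of order `Q n / k`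
on average over the first `n ≤ k²` steps. -/
lemma sum_ge_of_gain {n : ℕ} {k Q : ℝ} (hk : 1 ≤ k) (hnk : (n : ℝ) ≤ k ^ 2) {b c : ℕ → ℝ}
    (hb : ∀ T, 0 ≤ b T) (hc : ∀ T, 0 ≤ c T)
    (h : ∀ T < n, 2 * k * c T + b T + Q - 2 / k * b T ≤ 2 * k * c (T + 1) + b (T + 1)) :
    Q * (n * (n - 1) / 2) ≤ 4 * k * ∑ T ∈ Finset.range n, (2 * c T + b T) := by
  have hk0 : 0 < k := by linarith
  set S := ∑ T ∈ Finset.range n, b T with hS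
  have hS0 : 0 ≤ S := Finset.sum_nonneg fun T _ => hb T
  have h1 : ∀ M ≤ n, M * Q - 2 / k * ∑ T ∈ Finset.range M, b T ≤ 2 * k * c M + b M := by
    intro M
    induction M with
    | zero =>
      intro _
      have := hb 0
      have := mul_nonneg hk0.le (hc 0)
      simp only [Finset.range_zero, Finset.sum_empty]
      push_cast
      linarith
    | succ M ih =>
      intro hM
      have i1 := ih (by omega)
      have i2 := h M (by omega)
      rw [Finset.sum_range_succ]
      push_cast
      linarith
  have h2 : ∀ M ∈ Finset.range n, (M : ℝ) * Q - 2 / k * S ≤ 2 * k * c M + b M := by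
    intro M hM
    rw [Finset.mem_range] at hM
    refine le_trans ?_ (h1 M hM.le)
    have : ∑ T ∈ Finset.range M, b T ≤ S :=
      Finset.sum_le_sum_of_subset_of_nonneg
        (fun T hT => by simp only [Finset.mem_range] at *; omega) fun T _ _ => hb T
    have := mul_le_mul_of_nonneg_left this (show 0 ≤ 2 / k by positivity)
    linarith
  have h3 := Finset.sum_le_sum h2
  rw [Finset.sum_sub_distrib, Finset.sum_add_distrib, ← Finset.mul_sum, ← Finset.sum_mul,
    Finset.sum_const, Finset.card_range, nsmul_eq_mul] at h3
  have h4 : ∑ M ∈ Finset.range n, (M : ℝ) = n * (n - 1) / 2 := by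
    have : ∀ m : ℕ, ∑ M ∈ Finset.range m, (M : ℝ) = m * (m - 1) / 2 := by
      intro m
      induction m with
      | zero => simp
      | succ m ih => rw [Finset.sum_range_succ, ih]; push_cast; ring
    exact this n
  rw [h4] at h3
  have hC : 0 ≤ ∑ T ∈ Finset.range n, c T := Finset.sum_nonneg fun T _ => hc T
  have h5 : (n : ℝ) * (2 / k * S) ≤ 2 * k * S := by
    have : (n : ℝ) * (2 / k * S) = n * (2 * S) / k := by ring
    rw [this, div_le_iff₀ hk0]
    nlinarith
  have h6 : S ≤ k * S := by nlinarith
  rw [Finset.sum_add_distrib, ← Finset.mul_sum]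
  rw [← Finset.mul_sum] at h3
  nlinarith [mul_nonneg hk0.le hC, mul_nonneg hk0.le hS0]

/-- A deterministic algorithm has average cost at least `(n - 1) / (16 k)` over the inputs obtained
from a random grid input by stopping at a random time and continuing with zeros or ones. -/
lemma sum_cost_ge {n k : ℕ} (hn : 2 ≤ n) (hk : 0 < k) (hnk : n ≤ k ^ 2) (A : Algorithm n) :
    (k : ℝ) ^ n * (n * (n - 1) / 2) ≤ 4 * k * ∑ T ∈ Finset.range n, ∑ x : Fin n → Fin k,
      (cost (stopped (gridInput x) T 0) (A.arrange (stopped (gridInput x) T 0)) +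
        cost (stopped (gridInput x) T 1) (A.arrange (stopped (gridInput x) T 1))) := by
  have h := sum_ge_of_gain (n := n) (k := k) (Q := (k : ℝ) ^ n)
    (b := fun T => ∑ x : Fin n → Fin k, ∑ i, mixedTerm T (A.arrange (gridInput x)) i)
    (c := fun T => ∑ x : Fin n → Fin k, ∑ i,
      filledTerm T (gridInput x) (A.arrange (gridInput x)) i)
    (by exact_mod_cast hk) (by exact_mod_cast hnk)
    (fun T => Finset.sum_nonneg fun x _ => Finset.sum_nonneg fun i _ => mixedTerm_nonneg _ _ _)
    (fun T => Finset.sum_nonneg fun x _ => Finset.sum_nonneg fun i _ => filledTerm_nonneg _ _ _ _)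
    (fun T hT => by
      have := sum_gain hn hk A hT
      simpa only [Finset.sum_add_distrib, ← Finset.mul_sum] using this)
  refine h.trans (le_of_eq ?_)
  congr 1
  refine Finset.sum_congr rfl fun T _ => ?_
  simp only [cost_stopped_add A (gridInput_mem_Icc _), Finset.sum_add_distrib, ← Finset.mul_sum]

/-! ### The lower bound for randomized algorithms -/

lemma RandomizedAlgorithm.measurable_cost {n : ℕ} (A : RandomizedAlgorithm n) (X : Fin n → ℝ) :
    @Measurable A.Ω ℝ≥0∞ A.mΩ _ fun ω => ENNReal.ofReal (cost X ((A.alg ω).arrange X)) := by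
  let := A.mΩ
  let : MeasurableSpace (Equiv.Perm (Fin n)) := ⊤
  have h : Measurable fun ω => (A.alg ω).arrange X :=
    measurable_to_countable' fun f => A.measurableSet_arrange X f
  exact (measurable_from_top (f := fun f : Equiv.Perm (Fin n) =>
    ENNReal.ofReal (cost X f))).comp h

lemma RandomizedAlgorithm.expectedCost_le_ratio {n : ℕ} (A : RandomizedAlgorithm n) {X : Fin n → ℝ}
    (hX : ∀ i, X i ∈ Set.Icc (0 : ℝ) 1) : A.expectedCost X ≤ A.ratio (Set.Icc 0 1) := by
  have h1 : ENNReal.ofReal (opt X) ≤ 1 := by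
    simpa using ENNReal.ofReal_le_ofReal (opt_le_one hX)
  calc A.expectedCost X = A.expectedCost X / 1 := (div_one _).symm
    _ ≤ A.expectedCost X / ENNReal.ofReal (opt X) := ENNReal.div_le_div_left h1 _
    _ ≤ A.ratio (Set.Icc 0 1) := le_iSup₂_of_le X hX le_rfl

lemma randRatio_ge {n : ℕ} (hn : 2 ≤ n) :
    ENNReal.ofReal (1 / 64 * √(n : ℝ)) ≤ randRatio (Set.Icc 0 1) n := by
  refine le_iInf fun A => ?_
  let := A.mΩ
  have := A.isProb
  set k := n.sqrt + 1 with hk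
  have hnk : n ≤ k ^ 2 := by
    rw [pow_two]; exact (Nat.lt_succ_sqrt n).le
  have hk0 : 0 < k := by omega
  have hsq1 : (1 : ℝ) ≤ √(n : ℝ) := by
    rw [Real.one_le_sqrt]; exact_mod_cast (by omega : 1 ≤ n)
  have hk2 : (k : ℝ) ≤ 2 * √(n : ℝ) := by
    have := Real.nat_sqrt_le_real_sqrt (a := n)
    rw [hk]; push_cast; linarith
  have hkpos : (0 : ℝ) < k := by exact_mod_cast hk0
  set R := A.ratio (Set.Icc 0 1) with hR
  set K : ℝ := (k : ℝ) ^ n * (2 * n) with hKdef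
  have hn0 : (2 : ℝ) ≤ n := by exact_mod_cast hn
  have hK : 0 < K := by positivity
  have hdet : ∀ B : Algorithm n, K * (1 / 64 * √(n : ℝ)) ≤
      ∑ T ∈ Finset.range n, ∑ x : Fin n → Fin k,
      (cost (stopped (gridInput x) T 0) (B.arrange (stopped (gridInput x) T 0)) +
        cost (stopped (gridInput x) T 1) (B.arrange (stopped (gridInput x) T 1))) := by
    intro B
    have h := sum_cost_ge hn hk0 hnk B
    have h' : 4 * (k : ℝ) * (K * (1 / 64 * √(n : ℝ))) ≤ (k : ℝ) ^ n * (n * (n - 1) / 2) := by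
      have e1 : 4 * (k : ℝ) * (K * (1 / 64 * √(n : ℝ))) =
          (k : ℝ) ^ n * (n * (k * √(n : ℝ) / 8)) := by rw [hKdef]; ring
      rw [e1, mul_div_assoc (n : ℝ)]
      have hss : √(n : ℝ) * √(n : ℝ) = n := Real.mul_self_sqrt (by positivity)
      have : (k : ℝ) * √(n : ℝ) / 8 ≤ (n - 1) / 2 := by nlinarith
      gcongr
    exact le_of_mul_le_mul_left (h'.trans h) (by positivity)
  have hsum : ENNReal.ofReal (K * (1 / 64 * √(n : ℝ))) ≤
      ∑ T ∈ Finset.range n, ∑ x : Fin n → Fin k,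
        (A.expectedCost (stopped (gridInput x) T 0) +
          A.expectedCost (stopped (gridInput x) T 1)) := by
    have e : ∑ T ∈ Finset.range n, ∑ x : Fin n → Fin k,
        (A.expectedCost (stopped (gridInput x) T 0) +
          A.expectedCost (stopped (gridInput x) T 1)) =
        ∫⁻ ω, ∑ T ∈ Finset.range n, ∑ x : Fin n → Fin k,
          (ENNReal.ofReal (cost (stopped (gridInput x) T 0)
              ((A.alg ω).arrange (stopped (gridInput x) T 0))) +
            ENNReal.ofReal (cost (stopped (gridInput x) T 1)
              ((A.alg ω).arrange (stopped (gridInput x) T 1)))) ∂A.μ := by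
      have hm := A.measurable_cost
      have hm2 : ∀ T (x : Fin n → Fin k), Measurable fun ω =>
          ENNReal.ofReal (cost (stopped (gridInput x) T 0)
              ((A.alg ω).arrange (stopped (gridInput x) T 0))) +
            ENNReal.ofReal (cost (stopped (gridInput x) T 1)
              ((A.alg ω).arrange (stopped (gridInput x) T 1))) :=
        fun T x => (hm _).add (hm _)
      rw [lintegral_finsetSum _ fun T _ => Finset.measurable_fun_sum _ fun x _ => hm2 T x]
      refine Finset.sum_congr rfl fun T _ => ?_
      rw [lintegral_finsetSum _ fun x _ => hm2 T x]
      refine Finset.sum_congr rfl fun x _ => ?_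
      rw [lintegral_add_left (hm _)]
      rfl
    rw [e]
    calc ENNReal.ofReal (K * (1 / 64 * √(n : ℝ)))
        = ∫⁻ _, ENNReal.ofReal (K * (1 / 64 * √(n : ℝ))) ∂A.μ := by simp
      _ ≤ _ := by
        refine lintegral_mono fun ω => ?_
        refine (ENNReal.ofReal_le_ofReal (hdet (A.alg ω))).trans (le_of_eq ?_)
        rw [ENNReal.ofReal_sum_of_nonneg fun T _ => Finset.sum_nonneg fun x _ =>
          add_nonneg (cost_nonneg _ _) (cost_nonneg _ _)]
        refine Finset.sum_congr rfl fun T _ => ?_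
        rw [ENNReal.ofReal_sum_of_nonneg fun x _ =>
          add_nonneg (cost_nonneg _ _) (cost_nonneg _ _)]
        exact Finset.sum_congr rfl fun x _ => ENNReal.ofReal_add (cost_nonneg _ _) (cost_nonneg _ _)
  have hle : ∑ T ∈ Finset.range n, ∑ x : Fin n → Fin k,
        (A.expectedCost (stopped (gridInput x) T 0) +
          A.expectedCost (stopped (gridInput x) T 1)) ≤ ENNReal.ofReal K * R := by
    have h01 : ∀ T (x : Fin n → Fin k), A.expectedCost (stopped (gridInput x) T 0) +
          A.expectedCost (stopped (gridInput x) T 1) ≤ 2 * R := by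
      intro T x
      rw [two_mul]
      exact add_le_add
        (A.expectedCost_le_ratio (stopped_mem_Icc (gridInput_mem_Icc x) T (by simp)))
        (A.expectedCost_le_ratio (stopped_mem_Icc (gridInput_mem_Icc x) T (by simp)))
    refine (Finset.sum_le_sum fun T _ => Finset.sum_le_sum fun x _ => h01 T x).trans
      (le_of_eq ?_)
    have : ENNReal.ofReal K = (k : ℝ≥0∞) ^ n * (2 * n) := by
      rw [hKdef]
      rw [ENNReal.ofReal_mul (by positivity), ENNReal.ofReal_mul (by positivity),
        ENNReal.ofReal_pow (by positivity)]
      simp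
    rw [this]
    simp
    ring
  have := hsum.trans hle
  rw [ENNReal.ofReal_mul hK.le] at this
  exact (ENNReal.mul_le_mul_iff_right (by simpa using hK) ENNReal.ofReal_ne_top).1 this

/-! ### Segments of a partially filled array and their potential -/

/-- A maximal stretch of the array between two filled cells with no filled cell in between: the
values of the two bounding cells, and the number `len` of empty cells between them. Two adjacent
filled cells form a segment with `len = 0`. -/
structure Segment where
  /-- The value of the filled cell at the left end. -/
  left : ℝ
  /-- The number of empty cells. -/
  len : ℕ
  /-- The value of the filled cell at the right end. -/
  right : ℝ

/-- All segments have end values within distance `L` of the reference point `x₀`. -/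
def Within (x₀ L : ℝ) (T : Multiset Segment) : Prop :=
  ∀ s ∈ T, |s.left - x₀| ≤ L ∧ |s.right - x₀| ≤ L

/-- The bucket of `x` when `[x₀ - L, x₀ + L]` is divided into intervals of length `L / q`. For
`L = 0` (all values equal to `x₀`) the junk value `0` of the division gives a single bucket. -/
noncomputable def label (x₀ L : ℝ) (q : ℕ) (x : ℝ) : ℤ := ⌊(q : ℝ) * (x - x₀) / L⌋

/-- The number of empty cells. -/
def emptyCells (T : Multiset Segment) : ℕ := (T.map Segment.len).sum

/-- The segments that still have empty cells. -/
def openSegments (T : Multiset Segment) : Multiset Segment := T.filter fun s => s.len ≠ 0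

/-- The buckets of the left ends of the open segments. -/
noncomputable def openLabels (x₀ L : ℝ) (q : ℕ) (T : Multiset Segment) : Finset ℤ :=
  ((openSegments T).map fun s => label x₀ L q s.left).toFinset

/-- The contribution of a segment to the potential. A closed segment counts with its cost. An open
segment counts with a reserve for the cost of closing it, which is smaller for a long segment, so
that splitting a long segment into two long ones is affordable, and with a reserve
`32 L / q` for each of its empty cells. -/
noncomputable def Segment.weight (L : ℝ) (q : ℕ) (s : Segment) : ℝ :=
  if s.len = 0 then |s.right - s.left|
  else L * (4 - 2 * min (1 : ℝ) (12 * s.len / q)) + 32 * L * s.len / q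

/-- The potential: the present cost and the reserves. The term `-2 L |openLabels|` pays for
placing an item next to one from a different bucket, which opens a new bucket; the term `140 L q`
pays for making the buckets coarser. -/
noncomputable def potential (x₀ L : ℝ) (q : ℕ) (T : Multiset Segment) : ℝ :=
  (T.map (Segment.weight L q)).sum - 2 * L * (openLabels x₀ L q T).card + 140 * L * q

lemma label_eq_imp {x₀ L : ℝ} {q : ℕ} (hq : 0 < q) {x y : ℝ} (hx : |x - x₀| ≤ L)
    (hy : |y - x₀| ≤ L) (h : label x₀ L q x = label x₀ L q y) : |x - y| ≤ L / q := by
  have hq' : (0 : ℝ) < q := by exact_mod_cast hq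
  rcases (abs_nonneg _ |>.trans hx).eq_or_lt with hL | hL
  · rw [← hL, abs_nonpos_iff, sub_eq_zero] at hx hy
    simp [← hL, hx, hy]
  · have h1 := Int.abs_sub_lt_one_of_floor_eq_floor h
    have e : (q : ℝ) * (x - x₀) / L - q * (y - x₀) / L = (q / L) * (x - y) := by ring
    rw [e, abs_mul, abs_of_pos (by positivity), div_mul_eq_mul_div, div_lt_one hL] at h1
    rw [le_div_iff₀ hq']
    linarith

lemma label_mem_Icc {x₀ L : ℝ} (q : ℕ) {x : ℝ} (hx : |x - x₀| ≤ L) :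
    label x₀ L q x ∈ Finset.Icc (-(q : ℤ)) q := by
  have h : |(q : ℝ) * (x - x₀) / L| ≤ q := by
    rw [abs_div, abs_mul, Nat.abs_cast, abs_of_nonneg ((abs_nonneg _).trans hx)]
    exact div_le_of_le_mul₀ ((abs_nonneg _).trans hx) (by positivity) (by gcongr)
  rw [abs_le] at h
  rw [Finset.mem_Icc, label]
  constructor
  · rw [Int.le_floor]; push_cast; exact h.1
  · exact_mod_cast (Int.floor_le _).trans h.2

lemma openSegments_cons_zero {s : Segment} (h : s.len = 0) (T : Multiset Segment) :
    openSegments (s ::ₘ T) = openSegments T :=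
  Multiset.filter_cons_of_neg _ (by simp [h])

lemma openSegments_cons_pos {s : Segment} (h : s.len ≠ 0) (T : Multiset Segment) :
    openSegments (s ::ₘ T) = s ::ₘ openSegments T :=
  Multiset.filter_cons_of_pos _ h

lemma openLabels_cons_zero {x₀ L : ℝ} {q : ℕ} {s : Segment} (h : s.len = 0)
    (T : Multiset Segment) : openLabels x₀ L q (s ::ₘ T) = openLabels x₀ L q T := by
  rw [openLabels, openSegments_cons_zero h, openLabels]

lemma openLabels_cons_pos {x₀ L : ℝ} {q : ℕ} {s : Segment} (h : s.len ≠ 0)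
    (T : Multiset Segment) :
    openLabels x₀ L q (s ::ₘ T) = insert (label x₀ L q s.left) (openLabels x₀ L q T) := by
  rw [openLabels, openSegments_cons_pos h, openLabels, Multiset.map_cons,
    Multiset.toFinset_cons]

lemma card_openLabels_le (x₀ L : ℝ) (q : ℕ) (T : Multiset Segment) :
    (openLabels x₀ L q T).card ≤ (openSegments T).card := by
  simpa [openLabels] using
    Multiset.toFinset_card_le ((openSegments T).map fun s => label x₀ L q s.left)

lemma mem_openLabels {x₀ L : ℝ} {q : ℕ} {T : Multiset Segment} {a : ℤ} :
    a ∈ openLabels x₀ L q T ↔ ∃ s ∈ T, s.len ≠ 0 ∧ label x₀ L q s.left = a := by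
  simp [openLabels, openSegments, and_assoc]

lemma openLabels_subset {x₀ L : ℝ} (q : ℕ) {T : Multiset Segment} (hT : Within x₀ L T) :
    openLabels x₀ L q T ⊆ Finset.Icc (-(q : ℤ)) q := by
  intro a ha
  obtain ⟨s, hs, -, rfl⟩ := mem_openLabels.1 ha
  exact label_mem_Icc q (hT s hs).1

lemma card_openLabels_le_of_within {x₀ L : ℝ} (q : ℕ) {T : Multiset Segment}
    (hT : Within x₀ L T) : (openLabels x₀ L q T).card ≤ 2 * q + 1 := by
  have := Finset.card_le_card (openLabels_subset q hT)
  rw [Int.card_Icc] at this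
  omega

/-- Placing an item into cell `a` of a segment cuts the segment in two. -/
def Segment.cut (s : Segment) (a : ℕ) (x : ℝ) (t : Multiset Segment) : Multiset Segment :=
  ⟨s.left, a, x⟩ ::ₘ ⟨x, s.len - 1 - a, s.right⟩ ::ₘ t

lemma within_cut {x₀ L x : ℝ} {s : Segment} {a : ℕ} {t : Multiset Segment}
    (hT : Within x₀ L (s ::ₘ t)) (hx : |x - x₀| ≤ L) : Within x₀ L (s.cut a x t) := by
  have hs := hT s (Multiset.mem_cons_self s t)
  intro r hr
  rw [Segment.cut, Multiset.mem_cons, Multiset.mem_cons] at hr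
  rcases hr with rfl | rfl | hr
  · exact ⟨hs.1, hx⟩
  · exact ⟨hx, hs.2⟩
  · exact hT r (Multiset.mem_cons_of_mem hr)

lemma emptyCells_cut {x : ℝ} {s : Segment} {a : ℕ} (ha : a < s.len) (t : Multiset Segment) :
    emptyCells (s.cut a x t) + 1 = emptyCells (s ::ₘ t) := by
  simp only [emptyCells, Segment.cut, Multiset.map_cons, Multiset.sum_cons]
  omega

/-! ### Placing an item without increasing the potential -/

lemma weight_place_head {x₀ L x : ℝ} {q : ℕ} {s : Segment} (hq : 0 < q) (hL : 0 ≤ L)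
    (hs : s.len ≠ 0) (hx : |x - x₀| ≤ L) (hr : |s.right - x₀| ≤ L) :
    Segment.weight L q ⟨s.left, 0, x⟩ + Segment.weight L q ⟨x, s.len - 1 - 0, s.right⟩ ≤
      s.weight L q + |x - s.left| - 8 * L / q - if s.len = 1 then 2 * L else 0 := by
  have hq' : (0 : ℝ) < q := by exact_mod_cast hq
  have hLq : 0 ≤ L / q := by positivity
  unfold Segment.weight
  simp only [if_true, if_neg hs, Nat.sub_zero]
  by_cases h1 : s.len = 1
  · have hxr : |s.right - x| ≤ 2 * L := by
      have := abs_sub_le s.right x₀ x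
      rw [abs_sub_comm x₀ x] at this
      linarith
    have hmin : min (1 : ℝ) (12 * 1 / q) ≤ 12 * 1 / q := min_le_right _ _
    have := mul_le_mul_of_nonneg_left hmin hL
    have e1 : L * (12 * 1 / q) = 12 * (L / q) := by ring
    have e2 : 32 * L * 1 / q = 32 * (L / q) := by ring
    have e3 : 8 * L / q = 8 * (L / q) := by ring
    simp only [h1, Nat.sub_self, if_true, Nat.cast_one]
    linarith
  · have h2 : s.len - 1 ≠ 0 := by omega
    have hc : ((s.len - 1 : ℕ) : ℝ) = s.len - 1 := by
      rw [Nat.cast_sub (by omega)]; simp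
    have hmin : min (1 : ℝ) (12 * s.len / q) ≤ min (1 : ℝ) (12 * (s.len - 1) / q) + 12 / q := by
      have e : (12 : ℝ) * (s.len - 1) / q + 12 / q = 12 * s.len / q := by ring
      rw [← min_add_add_right, e]
      have : (0 : ℝ) ≤ 12 / q := by positivity
      exact min_le_min (by linarith) le_rfl
    have := mul_le_mul_of_nonneg_left hmin hL
    have e1 : L * (min (1 : ℝ) (12 * ((s.len : ℝ) - 1) / q) + 12 / q) =
      L * min (1 : ℝ) (12 * ((s.len : ℝ) - 1) / q) + 12 * (L / q) := by ring
    have e2 : 32 * L * ((s.len : ℝ) - 1) / q = 32 * L * s.len / q - 32 * (L / q) := by ring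
    have e3 : 8 * L / q = 8 * (L / q) := by ring
    simp only [h1, h2, if_false, hc, e2, e3]
    linarith

lemma potential_place_head {x₀ L x : ℝ} {q : ℕ} {s : Segment} {t : Multiset Segment}
    (hq : 0 < q) (hL : 0 ≤ L) (hs : s.len ≠ 0) (hx : |x - x₀| ≤ L) (hr : |s.right - x₀| ≤ L)
    (h : |x - s.left| + 2 * L * (openLabels x₀ L q (s ::ₘ t)).card ≤
      8 * L / q + (if s.len = 1 then 2 * L else 0) +
        2 * L * (openLabels x₀ L q (s.cut 0 x t)).card) :
    potential x₀ L q (s.cut 0 x t) ≤ potential x₀ L q (s ::ₘ t) := by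
  have := weight_place_head (x := x) hq hL hs hx hr
  simp only [potential, Segment.cut, Multiset.map_cons, Multiset.sum_cons] at *
  linarith

lemma openLabels_cut_head_one {x₀ L x : ℝ} {q : ℕ} {s : Segment} {t : Multiset Segment}
    (hs : s.len = 1) : openLabels x₀ L q (s.cut 0 x t) = openLabels x₀ L q t := by
  rw [Segment.cut, openLabels_cons_zero rfl, openLabels_cons_zero (by simp [hs])]

lemma openLabels_cut_head_of_ne_one {x₀ L x : ℝ} {q : ℕ} {s : Segment} {t : Multiset Segment}
    (hs : s.len ≠ 0) (hs' : s.len ≠ 1) :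
    openLabels x₀ L q (s.cut 0 x t) = insert (label x₀ L q x) (openLabels x₀ L q t) := by
  rw [Segment.cut, openLabels_cons_zero rfl, openLabels_cons_pos (by simp only; omega)]

lemma card_openSegments_cut_head_le {x : ℝ} {s : Segment} {t : Multiset Segment}
    (hs : s.len ≠ 0) :
    (openSegments (s.cut 0 x t)).card ≤ (openSegments (s ::ₘ t)).card := by
  rw [Segment.cut, openSegments_cons_zero rfl, openSegments_cons_pos hs, Multiset.card_cons]
  by_cases h : s.len = 1
  · rw [openSegments_cons_zero (by simp [h])]; omega
  · rw [openSegments_cons_pos (by simp only; omega), Multiset.card_cons]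

lemma potential_place_same_label {x₀ L x : ℝ} {q : ℕ} {s : Segment} {t : Multiset Segment}
    (hq : 0 < q) (hT : Within x₀ L (s ::ₘ t)) (hs : s.len ≠ 0) (hx : |x - x₀| ≤ L)
    (hl : label x₀ L q s.left = label x₀ L q x) :
    potential x₀ L q (s.cut 0 x t) ≤ potential x₀ L q (s ::ₘ t) := by
  have hL : 0 ≤ L := (abs_nonneg _).trans hx
  have hsT := hT s (Multiset.mem_cons_self s t)
  have hq' : (0 : ℝ) < q := by exact_mod_cast hq
  have hLq : 0 ≤ L / q := by positivity
  have hd := label_eq_imp hq hx hsT.1 hl.symm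
  refine potential_place_head hq hL hs hx hsT.2 ?_
  rw [openLabels_cons_pos hs, show 8 * L / q = 8 * (L / q) by ring]
  by_cases h1 : s.len = 1
  · rw [openLabels_cut_head_one h1, if_pos h1]
    have : ((insert (label x₀ L q s.left) (openLabels x₀ L q t)).card : ℝ) ≤
        (openLabels x₀ L q t).card + 1 := by exact_mod_cast Finset.card_insert_le _ _
    have := mul_le_mul_of_nonneg_left this (show 0 ≤ 2 * L by positivity)
    linarith
  · rw [openLabels_cut_head_of_ne_one hs h1, if_neg h1, hl]
    linarith

/-- If the bucket of the left end occurs at another open segment as well, then the segment may be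
given to a new bucket. -/
lemma potential_place_repeated {x₀ L x : ℝ} {q : ℕ} {s : Segment} {t : Multiset Segment}
    (hq : 0 < q) (hT : Within x₀ L (s ::ₘ t)) (hs : s.len ≠ 0) (hx : |x - x₀| ≤ L)
    (hl : label x₀ L q s.left ∈ openLabels x₀ L q t)
    (hxl : label x₀ L q x ∉ openLabels x₀ L q t) :
    potential x₀ L q (s.cut 0 x t) ≤ potential x₀ L q (s ::ₘ t) := by
  have hL : 0 ≤ L := (abs_nonneg _).trans hx
  have hsT := hT s (Multiset.mem_cons_self s t)
  have hLq : 0 ≤ L / q := by positivity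
  have hd : |x - s.left| ≤ 2 * L := by
    have := abs_sub_le x x₀ s.left
    rw [abs_sub_comm x₀] at this
    linarith [hsT.1]
  refine potential_place_head hq hL hs hx hsT.2 ?_
  rw [openLabels_cons_pos hs, Finset.insert_eq_of_mem hl, show 8 * L / q = 8 * (L / q) by ring]
  by_cases h1 : s.len = 1
  · rw [openLabels_cut_head_one h1, if_pos h1]
    linarith
  · rw [openLabels_cut_head_of_ne_one hs h1, if_neg h1, Finset.card_insert_of_notMem hxl]
    push_cast
    linarith

/-- For coarse buckets, the reserve `32 L / q` of the empty cell pays for any placement. -/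
lemma potential_place_of_le_four {x₀ L x : ℝ} {q : ℕ} {s : Segment} {t : Multiset Segment}
    (hq : 0 < q) (hq4 : q ≤ 4) (hT : Within x₀ L (s ::ₘ t)) (hs : s.len ≠ 0) (hx : |x - x₀| ≤ L)
    (hxl : label x₀ L q x ∉ openLabels x₀ L q t) :
    potential x₀ L q (s.cut 0 x t) ≤ potential x₀ L q (s ::ₘ t) := by
  have hL : 0 ≤ L := (abs_nonneg _).trans hx
  have hsT := hT s (Multiset.mem_cons_self s t)
  have hq' : (0 : ℝ) < q := by exact_mod_cast hq
  have hLq : 2 * L ≤ 8 * L / q := by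
    have : (q : ℝ) ≤ 4 := by exact_mod_cast hq4
    rw [le_div_iff₀ hq']
    nlinarith
  have hd : |x - s.left| ≤ 2 * L := by
    have := abs_sub_le x x₀ s.left
    rw [abs_sub_comm x₀] at this
    linarith [hsT.1]
  refine potential_place_head hq hL hs hx hsT.2 ?_
  have : ((openLabels x₀ L q (s ::ₘ t)).card : ℝ) ≤ (openLabels x₀ L q t).card + 1 := by
    rw [openLabels_cons_pos hs]
    exact_mod_cast Finset.card_insert_le _ _
  have := mul_le_mul_of_nonneg_left this (show 0 ≤ 2 * L by positivity)
  by_cases h1 : s.len = 1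
  · rw [openLabels_cut_head_one h1, if_pos h1]
    linarith
  · rw [openLabels_cut_head_of_ne_one hs h1, if_neg h1, Finset.card_insert_of_notMem hxl]
    push_cast
    linarith

/-- Placing an item of a new bucket into the middle of a long segment. -/
lemma potential_split {x₀ L x : ℝ} {q : ℕ} {s : Segment} {t : Multiset Segment}
    (hq : 0 < q) (hL : 0 ≤ L) (hs : 3 ≤ s.len) (hqs : q ≤ 2 * s.len)
    (hxl : label x₀ L q x ∉ openLabels x₀ L q (s ::ₘ t)) :
    potential x₀ L q (s.cut ((s.len - 1) / 2) x t) ≤ potential x₀ L q (s ::ₘ t) := by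
  have hq' : (0 : ℝ) < q := by exact_mod_cast hq
  set a := (s.len - 1) / 2 with ha
  set b := s.len - 1 - a with hb
  have ha0 : a ≠ 0 := by omega
  have hb0 : b ≠ 0 := by omega
  have hs0 : s.len ≠ 0 := by omega
  have hmin : ∀ c : ℕ, q ≤ 12 * c → min (1 : ℝ) (12 * c / q) = 1 := by
    intro c hc
    rw [min_eq_left]
    rw [le_div_iff₀ hq', one_mul]
    exact_mod_cast hc
  have hcard : (openLabels x₀ L q (s.cut a x t)).card =
      (openLabels x₀ L q (s ::ₘ t)).card + 1 := by
    rw [openLabels_cons_pos hs0] at hxl ⊢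
    rw [Segment.cut, openLabels_cons_pos ha0, openLabels_cons_pos hb0, Finset.insert_comm,
      Finset.card_insert_of_notMem hxl]
  have hw : Segment.weight L q ⟨s.left, a, x⟩ + Segment.weight L q ⟨x, b, s.right⟩ ≤
      s.weight L q + 2 * L := by
    unfold Segment.weight
    simp only [if_neg ha0, if_neg hb0, if_neg hs0]
    rw [hmin a (by omega), hmin b (by omega)]
    have h1 : L * min (1 : ℝ) (12 * s.len / q) ≤ L * 1 :=
      mul_le_mul_of_nonneg_left (min_le_left _ _) hL
    have h2 : 32 * L * a / q + 32 * L * b / q ≤ 32 * L * s.len / q := by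
      rw [← add_div, ← mul_add]
      have : ((a : ℝ) + b) ≤ s.len := by exact_mod_cast (by omega : a + b ≤ s.len)
      gcongr
    linarith
  have hcast : ((openLabels x₀ L q (s.cut a x t)).card : ℝ) =
      (openLabels x₀ L q (s ::ₘ t)).card + 1 := by exact_mod_cast hcard
  rw [potential, potential, hcast]
  simp only [Segment.cut, Multiset.map_cons, Multiset.sum_cons]
  rw [← hb]
  linarith

lemma exists_long_segment {T : Multiset Segment} {q : ℕ} (hq : 0 < q)
    (hm : q ^ 2 ≤ emptyCells T) (hcard : (openSegments T).card ≤ 2 * q) :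
    ∃ s ∈ T, s.len ≠ 0 ∧ q ≤ 2 * s.len := by
  by_contra! h
  have h1 : ∀ U : Multiset Segment, (∀ s ∈ U, s.len ≠ 0 → 2 * s.len < q) →
      2 * emptyCells U ≤ (openSegments U).card * (q - 1) := by
    intro U
    induction U using Multiset.induction with
    | empty => simp [emptyCells, openSegments]
    | cons s U ih =>
      intro hU
      have i1 := ih fun r hr => hU r (Multiset.mem_cons_of_mem hr)
      have i2 := hU s (Multiset.mem_cons_self s U)
      have e : emptyCells (s ::ₘ U) = s.len + emptyCells U := by simp [emptyCells]
      rw [e]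
      by_cases hs : s.len = 0
      · rw [openSegments_cons_zero hs]; omega
      · rw [openSegments_cons_pos hs, Multiset.card_cons, add_mul]
        have := i2 hs
        omega
  have h2 := h1 T h
  obtain ⟨p, rfl⟩ : ∃ p, q = p + 1 := ⟨q - 1, by omega⟩
  have h3 : (openSegments T).card * (p + 1 - 1) ≤ 2 * (p + 1) * p := Nat.mul_le_mul_right _ hcard
  nlinarith

/-- Every item of the current range has a placement that does not increase the potential. -/
lemma exists_placement {x₀ L x : ℝ} {q : ℕ} {T : Multiset Segment} (hq : 0 < q)
    (hT : Within x₀ L T) (hx : |x - x₀| ≤ L) (hm : q ^ 2 ≤ emptyCells T) :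
    ∃ s t a, T = s ::ₘ t ∧ a < s.len ∧
      potential x₀ L q (s.cut a x t) ≤ potential x₀ L q T ∧
      (openSegments (s.cut a x t)).card ≤ max (openSegments T).card (2 * q + 1) := by
  have hL : 0 ≤ L := (abs_nonneg _).trans hx
  by_cases hxl : label x₀ L q x ∈ openLabels x₀ L q T
  · obtain ⟨s, hs, hs0, hl⟩ := mem_openLabels.1 hxl
    obtain ⟨t, rfl⟩ := Multiset.exists_cons_of_mem hs
    exact ⟨s, t, 0, rfl, Nat.pos_of_ne_zero hs0,
      potential_place_same_label hq hT hs0 hx hl,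
      (card_openSegments_cut_head_le hs0).trans (le_max_left _ _)⟩
  by_cases hrep : ∃ s t, T = s ::ₘ t ∧ s.len ≠ 0 ∧ label x₀ L q s.left ∈ openLabels x₀ L q t
  · obtain ⟨s, t, rfl, hs0, hl⟩ := hrep
    have hxt : label x₀ L q x ∉ openLabels x₀ L q t := fun h =>
      hxl (by rw [openLabels_cons_pos hs0]; exact Finset.mem_insert_of_mem h)
    exact ⟨s, t, 0, rfl, Nat.pos_of_ne_zero hs0,
      potential_place_repeated hq hT hs0 hx hl hxt,
      (card_openSegments_cut_head_le hs0).trans (le_max_left _ _)⟩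
  · -- The open segments lie in different buckets, so there are at most `2 q` of them.
    have hnd : ((openSegments T).map fun s => label x₀ L q s.left).Nodup := by
      classical
      rw [Multiset.nodup_iff_ne_cons_cons]
      intro a u hau
      obtain ⟨s, hs, hsa, hu⟩ := (Multiset.map_eq_cons _ _ _ _).2 hau
      obtain ⟨hsT, hs0⟩ := Multiset.mem_filter.1 hs
      obtain ⟨t, rfl⟩ := Multiset.exists_cons_of_mem hsT
      rw [openSegments_cons_pos hs0, Multiset.erase_cons_head] at hu
      refine hrep ⟨s, t, rfl, hs0, ?_⟩
      rw [openLabels, hu, hsa]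
      simp
    have hcard : (openSegments T).card ≤ 2 * q := by
      have h1 : (openLabels x₀ L q T).card = (openSegments T).card := by
        rw [openLabels, Multiset.toFinset_card_of_nodup hnd, Multiset.card_map]
      have h2 : openLabels x₀ L q T ⊆ (Finset.Icc (-(q : ℤ)) q).erase (label x₀ L q x) :=
        Finset.subset_erase.2 ⟨openLabels_subset q hT, hxl⟩
      have h3 := Finset.card_le_card h2
      rw [Finset.card_erase_of_mem (label_mem_Icc q hx), Int.card_Icc] at h3
      omega
    obtain ⟨s, hs, hs0, hqs⟩ := exists_long_segment hq hm hcard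
    obtain ⟨t, rfl⟩ := Multiset.exists_cons_of_mem hs
    by_cases h3 : 3 ≤ s.len
    · refine ⟨s, t, (s.len - 1) / 2, rfl, by omega, potential_split hq hL h3 hqs hxl,
        le_max_of_le_right ?_⟩
      rw [openSegments_cons_pos hs0, Multiset.card_cons] at hcard
      rw [Segment.cut, openSegments_cons_pos (by simp only; omega),
        openSegments_cons_pos (by simp only; omega), Multiset.card_cons, Multiset.card_cons]
      omega
    · have hxt : label x₀ L q x ∉ openLabels x₀ L q t := fun h =>
        hxl (by rw [openLabels_cons_pos hs0]; exact Finset.mem_insert_of_mem h)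
      exact ⟨s, t, 0, rfl, Nat.pos_of_ne_zero hs0,
        potential_place_of_le_four hq (by omega) hT hs0 hx hxt,
        (card_openSegments_cut_head_le hs0).trans (le_max_left _ _)⟩

/-! ### Changing the fineness of the buckets and the scale -/

/-- The fineness of the buckets when `m` cells are empty: a power of two of order `√m`. -/
def fineness (m : ℕ) : ℕ := 2 ^ Nat.log 4 m

lemma fineness_pos (m : ℕ) : 0 < fineness m := by unfold fineness; positivity

lemma fineness_sq (m : ℕ) : fineness m ^ 2 = 4 ^ Nat.log 4 m := by
  rw [fineness, ← pow_mul, mul_comm, pow_mul]; norm_num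

lemma fineness_sq_le {m : ℕ} (hm : m ≠ 0) : fineness m ^ 2 ≤ m := by
  rw [fineness_sq]; exact Nat.pow_log_le_self 4 hm

lemma lt_four_mul_fineness_sq (m : ℕ) : m < 4 * fineness m ^ 2 := by
  rw [fineness_sq, ← pow_succ']; exact Nat.lt_pow_succ_log_self (by norm_num) m

lemma fineness_mono {m m' : ℕ} (h : m ≤ m') : fineness m ≤ fineness m' :=
  Nat.pow_le_pow_right (by norm_num) (Nat.log_mono_right h)

lemma fineness_eq_or (m : ℕ) :
    fineness m = fineness (m + 1) ∨ 2 * fineness m ≤ fineness (m + 1) := by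
  have h : Nat.log 4 m ≤ Nat.log 4 (m + 1) := Nat.log_mono_right (Nat.le_succ m)
  rcases h.eq_or_lt with h | h
  · left; rw [fineness, fineness, h]
  · right
    rw [fineness, fineness, ← pow_succ']
    exact Nat.pow_le_pow_right (by norm_num) h

lemma sum_weight_coarsen_le {L : ℝ} (hL : 0 ≤ L) {q q' : ℕ} (hq' : 0 < q') (hqq : q' ≤ q)
    (T : Multiset Segment) :
    (T.map (Segment.weight L q')).sum ≤
      (T.map (Segment.weight L q)).sum + 32 * L * emptyCells T / q' := by
  induction T using Multiset.induction with
  | empty => simp [emptyCells]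
  | cons s T ih =>
    have e : (emptyCells (s ::ₘ T) : ℝ) = s.len + emptyCells T := by simp [emptyCells]
    rw [Multiset.map_cons, Multiset.map_cons, Multiset.sum_cons, Multiset.sum_cons, e, mul_add,
      add_div]
    have hq0 : (0 : ℝ) < q' := by exact_mod_cast hq'
    have hq1 : (q' : ℝ) ≤ q := by exact_mod_cast hqq
    have : s.weight L q' ≤ s.weight L q + 32 * L * s.len / q' := by
      unfold Segment.weight
      split_ifs with h
      · have : 0 ≤ 32 * L * s.len / q' := by positivity
        linarith
      · have h1 : min (1 : ℝ) (12 * s.len / q) ≤ min (1 : ℝ) (12 * s.len / q') :=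
          min_le_min le_rfl (div_le_div_of_nonneg_left (by positivity) hq0 hq1)
        have h2 := mul_le_mul_of_nonneg_left h1 hL
        have h3 : 0 ≤ 32 * L * s.len / q := by positivity
        linarith
    linarith

/-- Reducing the fineness to half or less does not increase the potential. -/
lemma potential_coarsen {x₀ L : ℝ} (hL : 0 ≤ L) {q q' : ℕ} (hq' : 0 < q') (hqq : 2 * q' ≤ q)
    {T : Multiset Segment} (hT : Within x₀ L T) (hm : emptyCells T < 4 * q' ^ 2) :
    potential x₀ L q' T ≤ potential x₀ L q T := by
  have hq0 : (0 : ℝ) < q' := by exact_mod_cast hq'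
  have h1 := sum_weight_coarsen_le hL hq' (by omega : q' ≤ q) T
  have h2 : 32 * L * emptyCells T / q' ≤ 128 * L * q' := by
    rw [div_le_iff₀ hq0]
    have : (emptyCells T : ℝ) ≤ 4 * (q' : ℝ) ^ 2 := by exact_mod_cast hm.le
    have := mul_le_mul_of_nonneg_left this (show 0 ≤ 32 * L by positivity)
    nlinarith
  have h3 : ((openLabels x₀ L q T).card : ℝ) ≤ 2 * q + 1 := by
    exact_mod_cast card_openLabels_le_of_within q hT
  have h4 : (0 : ℝ) ≤ (openLabels x₀ L q' T).card := by positivity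
  have h5 : (2 : ℝ) * q' ≤ q := by exact_mod_cast hqq
  have h6 : (1 : ℝ) ≤ q' := by exact_mod_cast hq'
  have m3 := mul_le_mul_of_nonneg_left h3 hL
  have m4 := mul_nonneg hL h4
  have m5 := mul_le_mul_of_nonneg_left h5 hL
  have m6 := mul_le_mul_of_nonneg_left h6 hL
  unfold potential
  nlinarith

/-- The cost of the adjacent pairs of filled cells. -/
noncomputable def closedCost (T : Multiset Segment) : ℝ :=
  (T.map fun s => if s.len = 0 then |s.right - s.left| else 0).sum

lemma closedCost_le_sum_weight {L : ℝ} (hL : 0 ≤ L) (q : ℕ) (T : Multiset Segment) :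
    closedCost T ≤ (T.map (Segment.weight L q)).sum := by
  refine Multiset.sum_map_le_sum_map _ _ fun s _ => ?_
  unfold Segment.weight
  split_ifs with h
  · exact le_rfl
  · have h1 : L * min (1 : ℝ) (12 * s.len / q) ≤ L * 1 :=
      mul_le_mul_of_nonneg_left (min_le_left _ _) hL
    have h2 : 0 ≤ 32 * L * s.len / q := by positivity
    linarith

lemma sum_weight_le {L : ℝ} (hL : 0 ≤ L) (q : ℕ) (T : Multiset Segment) :
    (T.map (Segment.weight L q)).sum ≤
      closedCost T + 4 * L * (openSegments T).card + 32 * L * emptyCells T / q := by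
  induction T using Multiset.induction with
  | empty => simp [emptyCells, openSegments, closedCost]
  | cons s T ih =>
    have e1 : (emptyCells (s ::ₘ T) : ℝ) = s.len + emptyCells T := by simp [emptyCells]
    have e2 : closedCost (s ::ₘ T) = (if s.len = 0 then |s.right - s.left| else 0) +
      closedCost T := by simp [closedCost]
    rw [Multiset.map_cons, Multiset.sum_cons, e1, e2, mul_add, add_div, Segment.weight]
    by_cases h : s.len = 0
    · rw [openSegments_cons_zero h, if_pos h, if_pos h, h]
      simp only [Nat.cast_zero, mul_zero, zero_div]
      linarith
    · rw [openSegments_cons_pos h, if_neg h, if_neg h, Multiset.card_cons]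
      have h1 : 0 ≤ L * min (1 : ℝ) (12 * s.len / q) := by positivity
      push_cast
      linarith

/-- The state of the algorithm is good at scale `L`: all values are within `L` of `x₀`, there are
`O(N)` open segments, and the potential is `O(L N)`. Here `N` is the initial fineness. -/
structure Good (x₀ L : ℝ) (N : ℕ) (T : Multiset Segment) : Prop where
  nonneg : 0 ≤ L
  within : Within x₀ L T
  card_le : (openSegments T).card ≤ 3 * N
  potential_le : potential x₀ L (fineness (emptyCells T)) T ≤ 566 * L * N

/-- When the scale at least doubles, the bound on the potential grows enough to refill all
reserves. -/
lemma Good.rescale {x₀ L L' : ℝ} {N : ℕ} {T : Multiset Segment} (h : Good x₀ L N T)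
    (hLL : 2 * L ≤ L') (hN : fineness (emptyCells T) ≤ N) : Good x₀ L' N T := by
  have hL := h.nonneg
  have hL' : 0 ≤ L' := by linarith
  refine ⟨hL', fun s hs => ?_, h.card_le, ?_⟩
  · have := h.within s hs
    exact ⟨by linarith [this.1], by linarith [this.2]⟩
  set q := fineness (emptyCells T) with hq
  have hq0 : (0 : ℝ) < q := by exact_mod_cast fineness_pos _
  have hqN : (q : ℝ) ≤ N := by exact_mod_cast hN
  have hg : ((openSegments T).card : ℝ) ≤ 3 * N := by exact_mod_cast h.card_le
  have hd : ((openLabels x₀ L q T).card : ℝ) ≤ 3 * N :=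
    le_trans (by exact_mod_cast card_openLabels_le x₀ L q T) hg
  have hm : 32 * L' * emptyCells T / q ≤ 128 * L' * q := by
    rw [div_le_iff₀ hq0]
    have : (emptyCells T : ℝ) ≤ 4 * (q : ℝ) ^ 2 := by
      exact_mod_cast (lt_four_mul_fineness_sq (emptyCells T)).le
    have := mul_le_mul_of_nonneg_left this (show 0 ≤ 32 * L' by positivity)
    nlinarith
  have h1 := h.potential_le
  have h2 := closedCost_le_sum_weight hL q T
  have h3 := sum_weight_le hL' q T
  have h4 : (0 : ℝ) ≤ (openLabels x₀ L' q T).card := by positivity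
  have hN0 : (0 : ℝ) ≤ N := by positivity
  have m1 := mul_le_mul_of_nonneg_left hd hL
  have m2 := mul_le_mul_of_nonneg_left hg hL'
  have m3 := mul_le_mul_of_nonneg_left hqN hL'
  have m4 := mul_nonneg hL' h4
  have m5 := mul_nonneg hL hq0.le
  have m6 := mul_le_mul_of_nonneg_right hLL hN0
  unfold potential at h1 ⊢
  nlinarith

/-- One step of the algorithm: if necessary the scale is raised, to twice the distance of the new
item from `x₀`, and then the item is placed. -/
lemma Good.exists_step {x₀ L : ℝ} {N : ℕ} {T : Multiset Segment} (h : Good x₀ L N T)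
    (hm : emptyCells T ≠ 0) (hN : fineness (emptyCells T) ≤ N) (x : ℝ) :
    ∃ L' s t a, (L' = L ∨ L' = 2 * |x - x₀|) ∧ T = s ::ₘ t ∧ a < s.len ∧
      Good x₀ L' N (s.cut a x t) := by
  obtain ⟨L', hL', hx, hG⟩ : ∃ L', (L' = L ∨ L' = 2 * |x - x₀|) ∧ |x - x₀| ≤ L' ∧
      Good x₀ L' N T := by
    rcases le_or_gt |x - x₀| L with hx | hx
    · exact ⟨L, Or.inl rfl, hx, h⟩
    · exact ⟨2 * |x - x₀|, Or.inr rfl, by linarith [abs_nonneg (x - x₀)],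
        h.rescale (by linarith) hN⟩
  set q := fineness (emptyCells T) with hq
  obtain ⟨s, t, a, rfl, ha, hpot, hcard⟩ :=
    exists_placement (fineness_pos _) hG.within hx (fineness_sq_le hm)
  refine ⟨L', s, t, a, hL', rfl, ha, hG.nonneg, within_cut hG.within hx, ?_, ?_⟩
  · have := hG.card_le
    have := fineness_pos (emptyCells (s ::ₘ t))
    omega
  · refine le_trans ?_ (hpot.trans hG.potential_le)
    have hE := emptyCells_cut (x := x) ha t
    rw [← hE]
    rcases fineness_eq_or (emptyCells (s.cut a x t)) with h' | h'
    · rw [h']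
    · exact potential_coarsen hG.nonneg (fineness_pos _) h' (within_cut hG.within hx)
        (lt_four_mul_fineness_sq _)

lemma Good.closedCost_le {x₀ L : ℝ} {N : ℕ} {T : Multiset Segment} (h : Good x₀ L N T)
    (hm : emptyCells T = 0) : closedCost T ≤ 566 * L * N := by
  have h1 := h.potential_le
  have h2 := closedCost_le_sum_weight h.nonneg (fineness (emptyCells T)) T
  have h3 : openSegments T = 0 := by
    rw [openSegments, Multiset.filter_eq_nil]
    intro s hs
    rw [emptyCells, Multiset.sum_eq_zero_iff] at hm
    simpa using hm _ (Multiset.mem_map_of_mem _ hs)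
  have h4 : openLabels x₀ L (fineness (emptyCells T)) T = ∅ := by
    rw [openLabels, h3]; simp
  have h5 : 0 ≤ 140 * L * (fineness (emptyCells T) : ℝ) := by
    have := h.nonneg; positivity
  rw [potential, h4, Finset.card_empty] at h1
  push_cast at h1
  linarith

lemma good_init (x₀ : ℝ) (m N : ℕ) (hN : 0 < N) : Good x₀ 0 N {⟨x₀, m, x₀⟩} := by
  refine ⟨le_rfl, by simp [Within], ?_, ?_⟩
  · exact (Multiset.card_le_card (Multiset.filter_le _ _)).trans (by simp; omega)
  · simp [potential, Segment.weight]

/-! ### Partially filled arrays -/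

/-- A partially filled array. A virtual cell `n` behind the array holds a copy of the first item,
so that the cells `0, …, n - 1` are partitioned into stretches `[p, q)`, where `p` is filled,
`q` is the next filled cell, and the cells in between are empty. -/
structure Config where
  /-- The stretches `(p, q)`. -/
  segs : Finset (ℕ × ℕ)
  /-- The values of the filled cells. -/
  value : ℕ → ℝ
  /-- The cell that was filled last. -/
  last : ℕ
  /-- The present scale of the algorithm. -/
  scale : ℝ

/-- The values at the ends of a stretch and the number of its empty cells. -/
def toSegment (A : ℕ → ℝ) (p : ℕ × ℕ) : Segment := ⟨A p.1, p.2 - p.1 - 1, A p.2⟩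

/-- The segments of a partially filled array. -/
def Config.segments (c : Config) : Multiset Segment := c.segs.val.map (toSegment c.value)

/-- The filled cells of the array, without the virtual cell `n`. -/
def Config.filled (c : Config) : Finset ℕ := c.segs.image Prod.fst

/-- The stretches partition `{0, …, n - 1}`, there are `m` empty cells, and the potential
is under control. -/
structure Config.Valid (n : ℕ) (x₀ : ℝ) (N m : ℕ) (c : Config) : Prop where
  lt : ∀ p ∈ c.segs, p.1 < p.2
  le : ∀ p ∈ c.segs, p.2 ≤ n
  cover : ∀ e < n, ∃ p ∈ c.segs, p.1 ≤ e ∧ e < p.2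
  disjoint : ∀ p ∈ c.segs, ∀ p' ∈ c.segs, ∀ e, p.1 ≤ e → e < p.2 → p'.1 ≤ e → e < p'.2 → p = p'
  good : Good x₀ c.scale N c.segments
  emptyCells_eq : emptyCells c.segments = m

/-- The configuration `c'` arises from `c` by putting `x` into an empty cell, and is valid if
`c` is valid. -/
structure Config.Next (n : ℕ) (x₀ : ℝ) (N : ℕ) (c : Config) (x : ℝ) (c' : Config) : Prop where
  value_eq : c'.value = Function.update c.value c'.last x
  last_lt : c'.last < n
  last_notMem : c'.last ∉ c.filled
  last_mem : c'.last ∈ c'.filled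
  filled_subset : c.filled ⊆ c'.filled
  scale_eq : c'.scale = c.scale ∨ c'.scale = 2 * |x - x₀|
  valid : ∀ m, c.Valid n x₀ N (m + 1) → c'.Valid n x₀ N m

lemma Config.Valid.exists_next {n : ℕ} {x₀ : ℝ} {N m : ℕ} {c : Config}
    (h : c.Valid n x₀ N (m + 1)) (hN : fineness (m + 1) ≤ N) (x : ℝ) :
    ∃ c', c.Next n x₀ N x c' := by
  obtain ⟨L', s, t, a, hL', hst, ha, hG⟩ :=
    h.good.exists_step (by rw [h.emptyCells_eq]; omega) (by rw [h.emptyCells_eq]; exact hN) x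
  have hs : s ∈ c.segments := by rw [hst]; exact Multiset.mem_cons_self s t
  obtain ⟨p, hp, rfl⟩ := Multiset.mem_map.1 hs
  have hp' : p ∈ c.segs := hp
  have ha' : a < p.2 - p.1 - 1 := ha
  have ht : t = (c.segs.erase p).val.map (toSegment c.value) := by
    have : c.segments = toSegment c.value p ::ₘ
        (c.segs.erase p).val.map (toSegment c.value) := by
      rw [Config.segments, ← Multiset.map_cons, Finset.erase_val, Multiset.cons_erase hp]
    rw [this, Multiset.cons_inj_right] at hst
    exact hst.symm
  have hlt := h.lt
  have hdis := h.disjoint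
  set r := p.1 + 1 + a with hr
  have hr1 : p.1 < r := by omega
  have hr2 : r < p.2 := by omega
  have hne : ∀ p' ∈ c.segs, p'.1 ≠ r ∧ p'.2 ≠ r := by
    intro p' hp1
    have := hlt p' hp1
    constructor
    · intro h1
      have := hdis p' hp1 p hp' r (by omega) (by omega) (by omega) (by omega)
      subst this
      omega
    · intro h1
      have := hdis p' hp1 p hp' (r - 1) (by omega) (by omega) (by omega) (by omega)
      subst this
      omega
  have hnm2 : (r, p.2) ∉ c.segs.erase p := fun h1 => (hne _ (Finset.mem_of_mem_erase h1)).1 rfl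
  have hnm1 : (p.1, r) ∉ insert (r, p.2) (c.segs.erase p) := by
    intro h1
    rcases Finset.mem_insert.1 h1 with h1 | h1
    · have := congrArg Prod.fst h1
      simp only at this
      omega
    · exact (hne _ (Finset.mem_of_mem_erase h1)).2 rfl
  set c' : Config := ⟨insert (p.1, r) (insert (r, p.2) (c.segs.erase p)),
    Function.update c.value r x, r, L'⟩ with hc'
  have hmem : ∀ q, q ∈ c'.segs ↔ q = (p.1, r) ∨ q = (r, p.2) ∨ q ≠ p ∧ q ∈ c.segs := by
    intro q
    simp [hc']
  have hseg : c'.segments = (toSegment c.value p).cut a x t := by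
    have hcongr : (c.segs.erase p).val.map (toSegment (Function.update c.value r x)) =
        (c.segs.erase p).val.map (toSegment c.value) := by
      refine Multiset.map_congr rfl fun q hq => ?_
      have := hne q (Finset.mem_of_mem_erase hq)
      simp [toSegment, this.1, this.2]
    rw [Config.segments, hc', Finset.insert_val_of_notMem hnm1, Finset.insert_val_of_notMem hnm2,
      Multiset.map_cons, Multiset.map_cons, hcongr, ht, Segment.cut]
    have e1 : r - p.1 - 1 = a := by omega
    have e2 : p.2 - r - 1 = p.2 - p.1 - 1 - 1 - a := by omega
    simp [toSegment, hr1.ne, hr2.ne', e1, e2]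
  refine ⟨c', rfl, ?_, ?_, ?_, ?_, hL', fun m' hm' => ⟨?_, ?_, ?_, ?_, ?_, ?_⟩⟩
  · have := h.le p hp'
    simp only [hc']
    omega
  · intro h1
    obtain ⟨q, hq, hq'⟩ := Finset.mem_image.1 h1
    exact (hne q hq).1 hq'
  · exact Finset.mem_image.2 ⟨(r, p.2), (hmem _).2 (Or.inr (Or.inl rfl)), rfl⟩
  · intro e he
    obtain ⟨q, hq, rfl⟩ := Finset.mem_image.1 he
    by_cases hqp : q = p
    · subst hqp
      exact Finset.mem_image.2 ⟨(q.1, r), (hmem _).2 (Or.inl rfl), rfl⟩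
    · exact Finset.mem_image.2 ⟨q, (hmem _).2 (Or.inr (Or.inr ⟨hqp, hq⟩)), rfl⟩
  · intro q hq
    rcases (hmem q).1 hq with rfl | rfl | ⟨-, hq⟩
    exacts [hr1, hr2, hlt q hq]
  · intro q hq
    rcases (hmem q).1 hq with rfl | rfl | ⟨-, hq⟩
    · exact hr2.le.trans (h.le p hp')
    · exact h.le p hp'
    · exact h.le q hq
  · intro e he
    obtain ⟨q, hq, h1, h2⟩ := h.cover e he
    by_cases hqp : q = p
    · subst hqp
      rcases lt_or_ge e r with h3 | h3
      · exact ⟨(q.1, r), (hmem _).2 (Or.inl rfl), h1, h3⟩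
      · exact ⟨(r, q.2), (hmem _).2 (Or.inr (Or.inl rfl)), h3, h2⟩
    · exact ⟨q, (hmem _).2 (Or.inr (Or.inr ⟨hqp, hq⟩)), h1, h2⟩
  · -- A new stretch is contained in the old stretch `p`, hence disjoint from the other ones.
    have hin : ∀ q, (q = (p.1, r) ∨ q = (r, p.2)) → ∀ e, q.1 ≤ e → e < q.2 →
        p.1 ≤ e ∧ e < p.2 := by
      rintro q (rfl | rfl) e h1 h2
      · simp only at h1 h2; omega
      · simp only at h1 h2; omega
    have hout : ∀ q q', (q = (p.1, r) ∨ q = (r, p.2)) → q' ≠ p → q' ∈ c.segs →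
        ∀ e, q.1 ≤ e → e < q.2 → q'.1 ≤ e → e < q'.2 → False := by
      intro q q' hq hq1 hq2 e h1 h2 h3 h4
      have := hin q hq e h1 h2
      exact hq1 (hdis q' hq2 p hp' e h3 h4 this.1 this.2)
    intro q hq q' hq' e h1 h2 h3 h4
    rcases (hmem q).1 hq with e1 | e1 | ⟨e1, e1'⟩ <;>
      rcases (hmem q').1 hq' with e2 | e2 | ⟨e2, e2'⟩
    · rw [e1, e2]
    · subst e1 e2; simp only at h2 h3; omega
    · exact (hout q q' (Or.inl e1) e2 e2' e h1 h2 h3 h4).elim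
    · subst e1 e2; simp only at h1 h4; omega
    · rw [e1, e2]
    · exact (hout q q' (Or.inr e1) e2 e2' e h1 h2 h3 h4).elim
    · exact (hout q' q (Or.inl e2) e1 e1' e h3 h4 h1 h2).elim
    · exact (hout q' q (Or.inr e2) e1 e1' e h3 h4 h1 h2).elim
    · exact hdis q e1' q' e2' e h1 h2 h3 h4
  · rw [hseg]; exact hG
  · have h1 := emptyCells_cut (x := x) ha t
    rw [← hst, hm'.emptyCells_eq] at h1
    rw [hseg]
    omega

/-! ### The algorithm -/

/-- The array after the first item, which goes into cell `0`. -/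
def Config.init (n : ℕ) (x₀ : ℝ) : Config := ⟨{(0, n)}, fun _ => x₀, 0, 0⟩

open Classical in
/-- The configuration after placing `x`: some valid continuation, if there is one. -/
noncomputable def Config.place (n : ℕ) (x₀ : ℝ) (N : ℕ) (c : Config) (x : ℝ) : Config :=
  if h : ∃ c', c.Next n x₀ N x c' then h.choose else c

lemma Config.Valid.next_place {n : ℕ} {x₀ : ℝ} {N m : ℕ} {c : Config}
    (h : c.Valid n x₀ N (m + 1)) (hN : fineness (m + 1) ≤ N) (x : ℝ) :
    c.Next n x₀ N x (c.place n x₀ N x) := by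
  have h2 := h.exists_next hN x
  rw [Config.place, dif_pos h2]
  exact h2.choose_spec

/-- The configuration after the items `X 0, …, X t`. -/
noncomputable def run (n N : ℕ) (X : ℕ → ℝ) : ℕ → Config
  | 0 => Config.init n (X 0)
  | t + 1 => (run n N X t).place n (X 0) N (X (t + 1))

lemma run_congr {n N : ℕ} {X Y : ℕ → ℝ} {t : ℕ} (h : ∀ i ≤ t, X i = Y i) :
    run n N X t = run n N Y t := by
  induction t with
  | zero => rw [run, run, h 0 le_rfl]
  | succ t ih =>
    rw [run, run, ih fun i hi => h i (by omega), h 0 (Nat.zero_le _), h (t + 1) le_rfl]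

lemma valid_init {n N : ℕ} (hn : 0 < n) (hN : 0 < N) (x₀ : ℝ) :
    (Config.init n x₀).Valid n x₀ N (n - 1) where
  lt p hp := by
    rw [Config.init, Finset.mem_singleton] at hp
    subst hp; exact hn
  le p hp := by
    rw [Config.init, Finset.mem_singleton] at hp
    subst hp; exact le_rfl
  cover e he := ⟨(0, n), by simp [Config.init], Nat.zero_le _, he⟩
  disjoint p hp p' hp' := by
    rw [Config.init, Finset.mem_singleton] at hp hp'
    intros
    rw [hp, hp']
  good := by
    have := good_init x₀ (n - 1) N hN
    simpa [Config.init, Config.segments, toSegment] using this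
  emptyCells_eq := by simp [Config.init, Config.segments, toSegment, emptyCells]

lemma run_valid {n N : ℕ} (hN : fineness (n - 1) ≤ N) (X : ℕ → ℝ) {t : ℕ} (ht : t < n) :
    (run n N X t).Valid n (X 0) N (n - 1 - t) := by
  have hN0 : 0 < N := (fineness_pos _).trans_le hN
  induction t with
  | zero => exact valid_init ht hN0 _
  | succ t ih =>
    have h1 := ih (by omega)
    rw [show n - 1 - t = n - 1 - (t + 1) + 1 by omega] at h1
    exact (h1.next_place ((fineness_mono (by omega)).trans hN) (X (t + 1))).valid _ h1

lemma run_next {n N : ℕ} (hN : fineness (n - 1) ≤ N) (X : ℕ → ℝ) {t : ℕ} (ht : t + 1 < n) :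
    (run n N X t).Next n (X 0) N (X (t + 1)) (run n N X (t + 1)) := by
  have h1 := run_valid hN X (t := t) (by omega)
  rw [show n - 1 - t = n - 1 - (t + 1) + 1 by omega] at h1
  exact h1.next_place ((fineness_mono (by omega)).trans hN) (X (t + 1))

lemma run_last_lt {n N : ℕ} (hN : fineness (n - 1) ≤ N) (X : ℕ → ℝ) {t : ℕ} (ht : t < n) :
    (run n N X t).last < n := by
  cases t with
  | zero => exact ht
  | succ t => exact (run_next hN X ht).last_lt

lemma run_last_mem {n N : ℕ} (hN : fineness (n - 1) ≤ N) (X : ℕ → ℝ) {j t : ℕ} (hjt : j ≤ t)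
    (ht : t < n) : (run n N X j).last ∈ (run n N X t).filled := by
  induction t, hjt using Nat.le_induction with
  | base =>
    cases j with
    | zero => simp [run, Config.init, Config.filled]
    | succ j => exact (run_next hN X ht).last_mem
  | succ t hjt ih => exact (run_next hN X ht).filled_subset (ih (by omega))

lemma run_last_ne {n N : ℕ} (hN : fineness (n - 1) ≤ N) (X : ℕ → ℝ) {j t : ℕ} (hjt : j < t)
    (ht : t < n) : (run n N X j).last ≠ (run n N X t).last := by
  obtain ⟨t, rfl⟩ : ∃ u, t = u + 1 := ⟨t - 1, by omega⟩
  intro h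
  apply (run_next hN X ht).last_notMem
  rw [← h]
  exact run_last_mem hN X (by omega) (by omega)

lemma run_value {n N : ℕ} (hN : fineness (n - 1) ≤ N) (X : ℕ → ℝ) {j t : ℕ} (hjt : j ≤ t)
    (ht : t < n) : (run n N X t).value (run n N X j).last = X j := by
  induction t, hjt using Nat.le_induction with
  | base =>
    cases j with
    | zero => rfl
    | succ j => rw [(run_next hN X ht).value_eq, Function.update_self]
  | succ t hjt ih =>
    rw [(run_next hN X ht).value_eq,
      Function.update_of_ne (run_last_ne hN X (Nat.lt_succ_of_le hjt) ht), ih (by omega)]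

lemma run_scale_le {n N : ℕ} (hN : fineness (n - 1) ≤ N) (X : ℕ → ℝ) {R : ℝ}
    (hR : ∀ i < n, |X i - X 0| ≤ R) {t : ℕ} (ht : t < n) : (run n N X t).scale ≤ 2 * R := by
  induction t with
  | zero =>
    have := (abs_nonneg _).trans (hR 0 ht)
    change (0 : ℝ) ≤ 2 * R
    linarith
  | succ t ih =>
    rcases (run_next hN X ht).scale_eq with h | h
    · rw [h]; exact ih (by omega)
    · rw [h]; linarith [hR _ ht]

/-- The input as a sequence, continued by zeros. -/
noncomputable def extend {n : ℕ} (X : Fin n → ℝ) (i : ℕ) : ℝ := if h : i < n then X ⟨i, h⟩ else 0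

lemma extend_val {n : ℕ} (X : Fin n → ℝ) (i : Fin n) : extend X i.val = X i := dif_pos i.2

/-- The cells chosen by the algorithm. -/
noncomputable def runCell (n : ℕ) (X : Fin n → ℝ) (j : Fin n) : Fin n :=
  ⟨(run n (fineness (n - 1)) (extend X) j.val).last, run_last_lt le_rfl _ j.2⟩

lemma runCell_bijective (n : ℕ) (X : Fin n → ℝ) : Function.Bijective (runCell n X) := by
  refine Finite.injective_iff_bijective.1 fun i j hij => ?_
  have h := congrArg Fin.val hij
  rcases lt_trichotomy i.val j.val with h1 | h1 | h1
  · exact (run_last_ne le_rfl (extend X) h1 j.2 h).elim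
  · exact Fin.ext h1
  · exact (run_last_ne le_rfl (extend X) h1 i.2 h.symm).elim

/-- The deterministic algorithm that keeps the potential bounded. -/
noncomputable def sortingAlgorithm (n : ℕ) : Algorithm n where
  arrange X := (Equiv.ofBijective (runCell n X) (runCell_bijective n X)).symm
  online X Y j h := by
    simp only [Equiv.symm_symm, Equiv.ofBijective_apply]
    refine Fin.ext ?_
    change (run n _ (extend X) j.val).last = (run n _ (extend Y) j.val).last
    rw [run_congr]
    intro i hi
    have hin : i < n := hi.trans_lt j.2
    rw [extend, extend, dif_pos hin, dif_pos hin]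
    exact h _ (Fin.le_def.2 hi)

/-- In a full array, the segments are the pairs of adjacent cells. -/
lemma Config.Valid.sum_le_closedCost {n : ℕ} {x₀ : ℝ} {N : ℕ} {c : Config}
    (h : c.Valid n x₀ N 0) :
    ∑ i ∈ Finset.range (n - 1), |c.value (i + 1) - c.value i| ≤ closedCost c.segments := by
  have hlen : ∀ p ∈ c.segs, p.2 - p.1 - 1 = 0 := by
    intro p hp
    have := h.emptyCells_eq
    rw [emptyCells, Multiset.sum_eq_zero_iff] at this
    exact this _ (Multiset.mem_map_of_mem _ (Multiset.mem_map_of_mem (toSegment c.value) hp))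
  have hmem : ∀ i < n, (i, i + 1) ∈ c.segs := by
    intro i hi
    obtain ⟨p, hp, h1, h2⟩ := h.cover i hi
    have h3 := hlen p hp
    have : p = (i, i + 1) := Prod.ext (by simp only; omega) (by simp only; omega)
    rwa [← this]
  have e : closedCost c.segments = ∑ p ∈ c.segs, |c.value p.2 - c.value p.1| := by
    rw [closedCost, Config.segments, Multiset.map_map]
    refine congrArg Multiset.sum (Multiset.map_congr rfl fun p hp => ?_)
    simp [toSegment, hlen p hp]
  rw [e, ← Finset.sum_image (f := fun p : ℕ × ℕ => |c.value p.2 - c.value p.1|)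
    (g := fun i => (i, i + 1)) (fun i _ j _ hij => congrArg Prod.fst hij)]
  refine Finset.sum_le_sum_of_subset_of_nonneg ?_ fun _ _ _ => abs_nonneg _
  intro p hp
  obtain ⟨i, hi, rfl⟩ := Finset.mem_image.1 hp
  exact hmem i (by rw [Finset.mem_range] at hi; omega)

lemma cost_sortingAlgorithm_le {n : ℕ} (hn : 2 ≤ n) (X : Fin n → ℝ) :
    cost X ((sortingAlgorithm n).arrange X) ≤ 1132 * √(n : ℝ) * opt X := by
  set N := fineness (n - 1) with hNdef
  set c := run n N (extend X) (n - 1) with hc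
  have hv : c.Valid n (extend X 0) N 0 := by
    simpa using run_valid le_rfl (extend X) (show n - 1 < n by omega)
  have hval : ∀ i < n, content X ((sortingAlgorithm n).arrange X) i = c.value i := by
    intro i hi
    rw [content_of_lt X _ hi]
    set j := (sortingAlgorithm n).arrange X ⟨i, hi⟩ with hj
    have h1 : runCell n X j = ⟨i, hi⟩ :=
      (Equiv.ofBijective (runCell n X) (runCell_bijective n X)).apply_symm_apply ⟨i, hi⟩
    have h2 : (run n N (extend X) j.val).last = i := congrArg Fin.val h1
    have hj2 := j.2
    rw [← extend_val X j, ← h2, hc]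
    exact (run_value le_rfl (extend X) (by omega) (by omega)).symm
  have hcost : cost X ((sortingAlgorithm n).arrange X) ≤ 566 * c.scale * N := by
    rw [cost_eq_sum_range]
    refine le_trans (le_of_eq ?_) (hv.sum_le_closedCost.trans
      (hv.good.closedCost_le hv.emptyCells_eq))
    refine Finset.sum_congr rfl fun i hi => ?_
    rw [Finset.mem_range] at hi
    rw [hval i (by omega), hval (i + 1) (by omega)]
  have hscale : c.scale ≤ 2 * opt X := by
    refine run_scale_le le_rfl (extend X) (fun i hi => ?_) (show n - 1 < n by omega)
    have h0 : 0 < n := by omega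
    have := abs_sub_le_opt X ⟨i, hi⟩ ⟨0, h0⟩
    rwa [← extend_val X ⟨i, hi⟩, ← extend_val X ⟨0, h0⟩] at this
  have hN : (N : ℝ) ≤ √(n : ℝ) := by
    refine Real.le_sqrt_of_sq_le ?_
    have := fineness_sq_le (m := n - 1) (by omega)
    exact_mod_cast this.trans (Nat.sub_le n 1)
  have hopt := opt_nonneg X
  have hN0 : (0 : ℝ) ≤ N := by positivity
  calc cost X ((sortingAlgorithm n).arrange X) ≤ 566 * c.scale * N := hcost
    _ ≤ 566 * (2 * opt X) * N := by gcongr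
    _ ≤ 566 * (2 * opt X) * √(n : ℝ) := by gcongr
    _ = 1132 * √(n : ℝ) * opt X := by ring

/-! ### Competitive ratios -/

lemma ratio_sortingAlgorithm_le {n : ℕ} (hn : 2 ≤ n) :
    (sortingAlgorithm n).ratio Set.univ ≤ ENNReal.ofReal (1132 * √(n : ℝ)) := by
  refine iSup₂_le fun X _ => ?_
  refine ENNReal.div_le_of_le_mul ?_
  rw [← ENNReal.ofReal_mul (by positivity)]
  exact ENNReal.ofReal_le_ofReal (cost_sortingAlgorithm_le hn X)

/-- A deterministic algorithm as a randomized one, with a single random choice. -/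
noncomputable def Algorithm.toRandomized {n : ℕ} (A : Algorithm n) : RandomizedAlgorithm n where
  Ω := Unit
  μ := Measure.dirac ()
  alg := fun _ => A
  measurableSet_arrange := fun _ _ => MeasurableSet.of_discrete

lemma Algorithm.ratio_toRandomized {n : ℕ} (A : Algorithm n) (S : Set ℝ) :
    A.toRandomized.ratio S = A.ratio S := by
  have h : ∀ X, A.toRandomized.expectedCost X = ENNReal.ofReal (cost X (A.arrange X)) := by
    intro X
    change ∫⁻ _ : Unit, ENNReal.ofReal (cost X (A.arrange X)) ∂(Measure.dirac ()) = _
    simp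
  simp only [RandomizedAlgorithm.ratio, Algorithm.ratio, h]

lemma randRatio_le_detRatio (S : Set ℝ) (n : ℕ) : randRatio S n ≤ detRatio S n :=
  le_iInf fun A => (iInf_le _ A.toRandomized).trans_eq (A.ratio_toRandomized S)

lemma randRatio_mono {S S' : Set ℝ} (h : S ⊆ S') (n : ℕ) : randRatio S n ≤ randRatio S' n :=
  iInf_mono fun _ => iSup_mono fun _ => iSup_mono' fun hX => ⟨fun i => h (hX i), le_rfl⟩

end OnlineSorting

/-- The deterministic and the randomized competitive ratio of online sorting of `n` reals are
`Θ(√n)`; the upper bound is achieved by a deterministic algorithm on arbitrary real inputs, and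
the lower bound holds even when all inputs are from `[0,1]`. -/
theorem theorem1 :
    ∃ c C : ℝ, 0 < c ∧ 0 < C ∧ ∀ n : ℕ, 2 ≤ n →
      (ENNReal.ofReal (c * √(n : ℝ)) ≤ OnlineSorting.detRatio Set.univ n ∧
        OnlineSorting.detRatio Set.univ n ≤ ENNReal.ofReal (C * √(n : ℝ))) ∧
      (ENNReal.ofReal (c * √(n : ℝ)) ≤ OnlineSorting.randRatio Set.univ n ∧
        OnlineSorting.randRatio Set.univ n ≤ ENNReal.ofReal (C * √(n : ℝ))) ∧
      (∃ A : OnlineSorting.Algorithm n,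
        A.ratio Set.univ ≤ ENNReal.ofReal (C * √(n : ℝ))) ∧
      (ENNReal.ofReal (c * √(n : ℝ)) ≤ OnlineSorting.detRatio (Set.Icc 0 1) n ∧
        ENNReal.ofReal (c * √(n : ℝ)) ≤ OnlineSorting.randRatio (Set.Icc 0 1) n) := by
  refine ⟨1 / 64, 1132, by norm_num, by norm_num, fun n hn => ?_⟩
  have hlow := OnlineSorting.randRatio_ge hn
  have hup := OnlineSorting.ratio_sortingAlgorithm_le hn
  have hdet : OnlineSorting.detRatio Set.univ n ≤ ENNReal.ofReal (1132 * √(n : ℝ)) :=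
    (iInf_le _ (OnlineSorting.sortingAlgorithm n)).trans hup
  have hrd := OnlineSorting.randRatio_le_detRatio
  have hlow' := hlow.trans (OnlineSorting.randRatio_mono (Set.subset_univ _) n)
  exact ⟨⟨hlow'.trans (hrd _ n), hdet⟩, ⟨hlow', (hrd _ n).trans hdet⟩,
    ⟨OnlineSorting.sortingAlgorithm n, hup⟩, ⟨hlow.trans (hrd _ n), hlow⟩⟩
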